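/- Work in a fixed countably saturated nonstandard universe; ${}^*\mathbb N$ is its set of hypernatural numbers, and $\mathbb N\subseteq{}^*\mathbb N$ is the set of standard ones. Borel sets form the least $\sigma$-algebra containing all internal sets. A set $X$ is countably determined (CD) if there are internal sets $X_m$ $(m\in\mathbb N)$ and a family $B\subseteq\mathcal P(\mathbb N)$ with $$X=\bigcup_{b\in B}\Bigl(\bigcap_{m\in b}X_m\cap\bigcap_{m\notin b}\bigl(\textstyle\bigcup_n X_n\setminus X_m\bigr)\Bigr).$$ A map is CD if its graph is CD. Write $X\le_{CD}Y$ if there is a CD injection $X\to Y$, and $X\equiv_{CD}Y$ if $X\le_{CD}Y$ and $Y\le_{CD}X$. A cut is an initial segment of ${}^*\mathbb N$; it is additive if it is closed under addition. For a cut $U$ put $U\mathbb N=\bigcup_{n\in\mathbb N,\,x\in U}[0,xn]$. For a nonnegative hyperrational $\alpha$, $\operatorname{st}\alpha$ is the real number infinitely close to $\alpha$ if $\alpha$ is bounded by a standard number, and $+\infty$ otherwise. 1. If $U$ is an infinite Borel cut, then $U\equiv_{CD}\mathbb N\times U$ and $U\equiv_{CD}U\mathbb N$. 2. If $U\subsetneq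 V$ are Borel cuts and $U$ is additive, then there is no CD map from $U$ onto $V$. 3. Let $x,y\in{}^*\mathbb N$ with $y\ne0$ and $x,y$ not both in $\mathbb N$. Then $[0,x)\equiv_{CD}[0,y)$ if and only if $0<\operatorname{st}(x/y)<\infty$. -/

import Mathlib

universe u

/-- The finite types over the two ground types `ℕ` and `ℝ`. -/
inductive Ty : Type
  | nat : Ty
  | real : Ty
  | prod : Ty → Ty → Ty
  | pow : Ty → Ty
  deriving DecidableEq

/-- The standard objects of each type: numbers, ordered pairs, and all sets. -/
@[reducible] def Std : Ty → Type
  | Ty.nat => ℕ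
  | Ty.real => ℝ
  | Ty.prod a b => Std a × Std b
  | Ty.pow a => Set (Std a)

/-- A (Henkin) frame for the language of finite types with membership and pairing. -/
structure Frame : Type (u + 1) where
  /-- the objects of each type -/
  D : Ty → Type u
  /-- membership of an object of type `a` in an object of type `pow a` -/
  mem : {a : Ty} → D a → D (Ty.pow a) → Prop
  /-- ordered pairs -/
  pair : {a b : Ty} → D a → D b → D (Ty.prod a b)

/-- The standard frame: true membership, true pairs. -/
def stdFrame : Frame.{0} where
  D := Std
  mem := fun x A => x ∈ A
  pair := fun x y => (x, y)

/-- Formulas of the language of finite types. There are variables `x^a_i` for every type `a` and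
every index `i : ℕ`. -/
inductive Fml : Type
  /-- `x^a_i = x^a_j` -/
  | eq (a : Ty) (i j : ℕ) : Fml
  /-- `x^a_i ∈ x^(pow a)_j` -/
  | mem (a : Ty) (i j : ℕ) : Fml
  /-- `x^(prod a b)_k = (x^a_i, x^b_j)` -/
  | pair (a b : Ty) (i j k : ℕ) : Fml
  | neg (φ : Fml) : Fml
  | and (φ ψ : Fml) : Fml
  /-- `∀ x^a_i, φ` -/
  | all (a : Ty) (i : ℕ) (φ : Fml) : Fml

namespace Frame

/-- Values for all the variables. -/
abbrev Assignment (M : Frame.{u}) : Type u := ∀ a : Ty, ℕ → M.D a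

/-- The assignment `v` with the value of `x^a_i` changed to `x`. -/
def Assignment.set {M : Frame.{u}} (v : M.Assignment) (a : Ty) (i : ℕ) (x : M.D a) :
    M.Assignment :=
  Function.update v a (Function.update (v a) i x)

/-- Truth of a formula in a frame. -/
def Sat (M : Frame.{u}) : Fml → M.Assignment → Prop
  | Fml.eq a i j, v => v a i = v a j
  | Fml.mem a i j, v => M.mem (v a i) (v (Ty.pow a) j)
  | Fml.pair a b i j k, v => v (Ty.prod a b) k = M.pair (v a i) (v b j)
  | Fml.neg φ, v => ¬ Sat M φ v
  | Fml.and φ ψ, v => Sat M φ v ∧ Sat M ψ v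
  | Fml.all a i φ, v => ∀ x : M.D a, Sat M φ (v.set a i x)

theorem Assignment.set_self {M : Frame.{u}} (v : M.Assignment) (a : Ty) (i : ℕ) (x : M.D a) :
    v.set a i x a i = x := by
  simp [Assignment.set]

theorem Assignment.set_ne {M : Frame.{u}} (v : M.Assignment) (a : Ty) (i : ℕ) (x : M.D a)
    (b : Ty) (j : ℕ) (h : j ≠ i) : v.set a i x b j = v b j := by
  by_cases hb : b = a
  · subst hb
    simp [Assignment.set, h]
  · simp [Assignment.set, hb]

/-- The formula `∀ x^a_0, ∃ x^b_1, (x_0, x_1) ∈ x_3 ∧ ∀ x^b_4, (x_0, x_4) ∈ x_3 → x_4 = x_1`: the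
relation `x_3` is the graph of a function. -/
def graphFml (a b : Ty) : Fml :=
  let θ : ℕ → Fml := fun i => Fml.neg (Fml.all (Ty.prod a b) 2
    (Fml.neg (Fml.and (Fml.pair a b 0 i 2) (Fml.mem (Ty.prod a b) 2 3))))
  Fml.all a 0 (Fml.neg (Fml.all b 1 (Fml.neg (Fml.and (θ 1)
    (Fml.all b 4 (Fml.neg (Fml.and (θ 4) (Fml.neg (Fml.eq b 4 1)))))))))

theorem sat_graphFml (M : Frame.{u}) (a b : Ty) (v : M.Assignment) :
    M.Sat (graphFml a b) v ↔
      ∀ x : M.D a, ∃! y : M.D b, M.mem (M.pair x y) (v (Ty.pow (Ty.prod a b)) 3) := by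
  simp [graphFml, Frame.Sat, Assignment.set_self, Assignment.set_ne, ExistsUnique]

end Frame

/-- A countably saturated nonstandard universe over the finite types above `ℕ` and `ℝ`: a frame
with a map `star` from the standard objects that satisfies the transfer principle, and in which
every countable family of internal sets with the finite intersection property has a common
element. The members of `D a` are the internal objects of type `a`. -/
structure NonstandardUniverse : Type (u + 1) extends Frame.{u} where
  star : {a : Ty} → Std a → D a
  transfer : ∀ (φ : Fml) (v : stdFrame.Assignment),
    stdFrame.Sat φ v ↔ toFrame.Sat φ (fun a i => star (v a i))
  saturated : ∀ (a : Ty) (A : ℕ → D (Ty.pow a)),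
    (∀ n : ℕ, ∃ x : D a, ∀ i < n, mem x (A i)) → ∃ x : D a, ∀ i, mem x (A i)

namespace NonstandardUniverse

/-- `*f(x)` exists and is unique: the star of the graph of a standard function is the graph of a
function. -/
theorem existsUnique_starFun (M : NonstandardUniverse.{u}) {a b : Ty} (f : Std a → Std b)
    (x : M.D a) :
    ∃! y : M.D b, M.mem (M.pair x y) (M.star (a := Ty.pow (Ty.prod a b)) {p | p.2 = f p.1}) := by
  have hne : ∀ c : Ty, Nonempty (Std c) := by
    intro c
    induction c with
    | nat => exact ⟨(0 : ℕ)⟩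
    | real => exact ⟨(0 : ℝ)⟩
    | prod a b iha ihb => exact ⟨(iha.some, ihb.some)⟩
    | pow a _ => exact ⟨(∅ : Set (Std a))⟩
  let v : stdFrame.Assignment := Frame.Assignment.set (M := stdFrame) (fun c _ => (hne c).some)
    (Ty.pow (Ty.prod a b)) 3 ({p | p.2 = f p.1} : Set (Std a × Std b))
  have hv : v (Ty.pow (Ty.prod a b)) 3 = ({p | p.2 = f p.1} : Set (Std a × Std b)) :=
    Frame.Assignment.set_self _ _ _ _
  have key := (M.transfer (Frame.graphFml a b) v).1
    ((Frame.sat_graphFml _ a b v).2 fun y => by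
      rw [hv]
      exact ⟨f y, rfl, fun z hz => hz⟩)
  have h := (Frame.sat_graphFml _ a b _).1 key x
  rw [hv] at h
  exact h

/-- The extension `*f` of a standard function to the internal objects. -/
noncomputable def starFun (M : NonstandardUniverse.{u}) {a b : Ty} (f : Std a → Std b)
    (x : M.D a) : M.D b :=
  (M.existsUnique_starFun f x).choose

/-- The extension `*R` of a standard binary relation to the internal objects. -/
def starRel (M : NonstandardUniverse.{u}) {a b : Ty} (R : Std a → Std b → Prop)
    (x : M.D a) (y : M.D b) : Prop :=
  M.mem (M.pair x y) (M.star (a := Ty.pow (Ty.prod a b)) {p | R p.1 p.2})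

/-- The hypernatural numbers `*ℕ`. -/
abbrev HNat (M : NonstandardUniverse.{u}) : Type u := M.D Ty.nat

/-- The hyperreal numbers `*ℝ`. -/
abbrev HReal (M : NonstandardUniverse.{u}) : Type u := M.D Ty.real

/-- The set `ℕ` of standard elements of `*ℕ`. -/
def stdNat (M : NonstandardUniverse.{u}) : Set M.HNat :=
  Set.range fun n : ℕ => M.star (a := Ty.nat) n

def le (M : NonstandardUniverse.{u}) (x y : M.HNat) : Prop :=
  M.starRel (a := Ty.nat) (b := Ty.nat) (fun m n : ℕ => m ≤ n) x y

def lt (M : NonstandardUniverse.{u}) (x y : M.HNat) : Prop :=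
  M.starRel (a := Ty.nat) (b := Ty.nat) (fun m n : ℕ => m < n) x y

noncomputable def add (M : NonstandardUniverse.{u}) (x y : M.HNat) : M.HNat :=
  M.starFun (a := Ty.prod Ty.nat Ty.nat) (b := Ty.nat) (fun p : ℕ × ℕ => p.1 + p.2) (M.pair x y)

noncomputable def mul (M : NonstandardUniverse.{u}) (x y : M.HNat) : M.HNat :=
  M.starFun (a := Ty.prod Ty.nat Ty.nat) (b := Ty.nat) (fun p : ℕ × ℕ => p.1 * p.2) (M.pair x y)

/-- The quotient `x / y` of two hypernatural numbers. -/
noncomputable def ratio (M : NonstandardUniverse.{u}) (x y : M.HNat) : M.HReal :=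
  M.starFun (a := Ty.prod Ty.nat Ty.nat) (b := Ty.real) (fun p : ℕ × ℕ => (p.1 : ℝ) / (p.2 : ℝ))
    (M.pair x y)

/-- `α ≃ β`: the difference is infinitesimal, that is, smaller in absolute value than every
standard positive real. -/
def Near (M : NonstandardUniverse.{u}) (α β : M.HReal) : Prop :=
  ∀ ε : ℝ, 0 < ε → M.starRel (a := Ty.real) (b := Ty.real) (fun s t : ℝ => s < t)
    (M.starFun (a := Ty.prod Ty.real Ty.real) (b := Ty.real) (fun p : ℝ × ℝ => |p.1 - p.2|)
      (M.pair α β))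
    (M.star (a := Ty.real) ε)

open Classical in
/-- The standard part of a nonnegative hyperreal: the real number infinitely close to it, or `+∞`
if there is none (that is, if it is unbounded). -/
noncomputable def st (M : NonstandardUniverse.{u}) (α : M.HReal) : EReal :=
  if h : ∃ r : ℝ, M.Near α (M.star (a := Ty.real) r) then ((h.choose : ℝ) : EReal) else ⊤

/-- The set of elements of an internal set. -/
def ext (M : NonstandardUniverse.{u}) {a : Ty} (A : M.D (Ty.pow a)) : Set (M.D a) :=
  {x | M.mem x A}

/-- A set of objects of type `a` is internal if it is the set of elements of an internal object of
type `pow a`. -/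
def IsInternal (M : NonstandardUniverse.{u}) {a : Ty} (X : Set (M.D a)) : Prop :=
  ∃ A : M.D (Ty.pow a), X = M.ext A

/-- Borel sets: the least σ-algebra that contains all internal sets. -/
def IsBorel (M : NonstandardUniverse.{u}) {a : Ty} (X : Set (M.D a)) : Prop :=
  @MeasurableSet _ (MeasurableSpace.generateFrom {Y : Set (M.D a) | M.IsInternal Y}) X

/-- Countably determined sets. -/
def IsCD (M : NonstandardUniverse.{u}) {a : Ty} (X : Set (M.D a)) : Prop :=
  ∃ (Y : ℕ → Set (M.D a)) (B : Set (Set ℕ)), (∀ m, M.IsInternal (Y m)) ∧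
    X = ⋃ b ∈ B, ((⋂ m ∈ b, Y m) ∩ ⋂ m ∈ bᶜ, ((⋃ n, Y n) \ Y m))

/-- A map from `X` to `Y` is countably determined if its graph is. -/
def IsCDMap (M : NonstandardUniverse.{u}) {a b : Ty} {X : Set (M.D a)} {Y : Set (M.D b)}
    (f : X → Y) : Prop :=
  M.IsCD {z : M.D (Ty.prod a b) | ∃ x : X, z = M.pair (x : M.D a) (f x : M.D b)}

/-- There is a countably determined injection of `X` into `Y`. -/
def CDLe (M : NonstandardUniverse.{u}) {a b : Ty} (X : Set (M.D a)) (Y : Set (M.D b)) : Prop :=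
  ∃ f : X → Y, Function.Injective f ∧ M.IsCDMap f

/-- `X ≡_CD Y`. -/
def CDEquiv (M : NonstandardUniverse.{u}) {a b : Ty} (X : Set (M.D a)) (Y : Set (M.D b)) :
    Prop :=
  M.CDLe X Y ∧ M.CDLe Y X

/-- The Cartesian product of two sets, as a set of internal pairs. -/
def prodSet (M : NonstandardUniverse.{u}) {a b : Ty} (X : Set (M.D a)) (Y : Set (M.D b)) :
    Set (M.D (Ty.prod a b)) :=
  {z | ∃ x ∈ X, ∃ y ∈ Y, z = M.pair x y}

/-- Cuts: the initial segments of `*ℕ`. -/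
def IsCut (M : NonstandardUniverse.{u}) (U : Set M.HNat) : Prop :=
  ∀ x ∈ U, ∀ y, M.le y x → y ∈ U

/-- Closure under addition. -/
def IsAdditive (M : NonstandardUniverse.{u}) (U : Set M.HNat) : Prop :=
  ∀ x ∈ U, ∀ y ∈ U, M.add x y ∈ U

/-- `Uℕ = ⋃_{n ∈ ℕ, x ∈ U} [0, xn]`. -/
def mulNat (M : NonstandardUniverse.{u}) (U : Set M.HNat) : Set M.HNat :=
  ⋃ n : ℕ, ⋃ x ∈ U, {y | M.le y (M.mul x (M.star (a := Ty.nat) n))}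

/-- The interval `[0, x)` of `*ℕ`. -/
def below (M : NonstandardUniverse.{u}) (x : M.HNat) : Set M.HNat :=
  {y | M.lt y x}

end NonstandardUniverse

/-! Two facts carry the theorem, one constructing injections and one excluding surjections.

Construction (`cdLe_below`). Let `x` be infinite, and let a CD set be mapped injectively by a
standard function `g` into the multiples `xℕ`. Each `g z / x` has a real standard part `r`. A
Vitali-type argument gives `q : ℝ → ℚ` such that `r ↦ r + q r` is injective with values in `(0, 1)`.
Shifting `g z` by `⌊q r * x⌋` lands below `x`. The standard part of the result determines `r`, hence
the shift, hence `z`. However wild `q` is, the map is CD: `r` is determined by the internal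
conditions `g z / x < p` with `p` rational, and only countably many internal shifts occur.

Exclusion (`IsCD.not_forall_lt_exists`). By saturation a CD functional relation is covered by
countably many internal ones. If `v` is infinite, the `n`-th of these sends the arguments below `v /
2 ^ (n + 2)` to at most `v / 2 ^ (n + 2) + 1` values. Finitely many such images together have fewer
than `v` elements, so by saturation some value below `v` is missed by all of them. Hence arguments
infinitely smaller than `v` cannot produce every value below `v`.

For intervals, a ratio with standard part in `(0, ∞)` allows the construction in both directions,
and any other ratio makes one endpoint infinitely smaller than the other. For `U` additive and `v ∉
U`, every element of `U` is infinitely smaller than `v`, up to the trivial case `U = {0}`. For an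
infinite cut, `(n, x) ↦ 2 ^ n * (2 * x + 1)` embeds `ℕ × U` into `Uℕ`. Either `Uℕ = U`, or `Uℕ = xℕ`
for an infinite `x ∈ U` and the construction goes back into `[0, x) ⊆ U`. -/

namespace NonstandardUniverse

open Filter Topology

/-! ### Transfer, recast as a Łoś theorem for ultrafilters on standard objects. -/

section Transfer

variable (M : NonstandardUniverse.{u}) {a b c : Ty}

theorem nonempty_std (a : Ty) : Nonempty (Std a) := by
  induction a with
  | nat => exact ⟨(0 : ℕ)⟩
  | real => exact ⟨(0 : ℝ)⟩
  | prod a b iha ihb => exact ⟨(iha.some, ihb.some)⟩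
  | pow a _ => exact ⟨(∅ : Set (Std a))⟩

/-- An arbitrary assignment of standard objects. -/
noncomputable def baseAssignment : ∀ a : Ty, ℕ → Std a := fun a _ => (nonempty_std a).some

/-- The standard assignment `v` with the value of `x^a_i` changed to `x`. -/
def stdSet (v : ∀ a : Ty, ℕ → Std a) (a : Ty) (i : ℕ) (x : Std a) : ∀ a : Ty, ℕ → Std a :=
  Frame.Assignment.set (M := stdFrame) v a i x

theorem stdSet_self (v : ∀ a : Ty, ℕ → Std a) (a : Ty) (i : ℕ) (x : Std a) :
    stdSet v a i x a i = x :=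
  Frame.Assignment.set_self (M := stdFrame) v a i x

theorem stdSet_ne (v : ∀ a : Ty, ℕ → Std a) (a : Ty) (i : ℕ) (x : Std a) (b : Ty) (j : ℕ)
    (h : j ≠ i) : stdSet v a i x b j = v b j :=
  Frame.Assignment.set_ne (M := stdFrame) v a i x b j h

/-- Truth of a formula in the standard frame, spelled out. -/
def StdSat : Fml → (∀ a : Ty, ℕ → Std a) → Prop
  | Fml.eq a i j, v => v a i = v a j
  | Fml.mem a i j, v => v a i ∈ v (Ty.pow a) j
  | Fml.pair a b i j k, v => v (Ty.prod a b) k = (v a i, v b j)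
  | Fml.neg φ, v => ¬ StdSat φ v
  | Fml.and φ ψ, v => StdSat φ v ∧ StdSat ψ v
  | Fml.all a i φ, v => ∀ x : Std a, StdSat φ (stdSet v a i x)

theorem stdSat_iff (φ : Fml) : ∀ v : ∀ a : Ty, ℕ → Std a, StdSat φ v ↔ stdFrame.Sat φ v := by
  induction φ with
  | eq | mem | pair => exact fun _ => Iff.rfl
  | neg φ ih => exact fun v => not_congr (ih v)
  | and φ ψ ih1 ih2 => exact fun v => and_congr (ih1 v) (ih2 v)
  | all a i φ ih => exact fun v => forall_congr' fun x => ih _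

/-- The image of a standard assignment under `star`. -/
def starAssignment (v : ∀ a : Ty, ℕ → Std a) : M.toFrame.Assignment := fun a i => M.star (v a i)

theorem starAssignment_stdSet (v : ∀ a : Ty, ℕ → Std a) (a : Ty) (i : ℕ) (x : Std a) :
    M.starAssignment (stdSet v a i x) =
      Frame.Assignment.set (M := M.toFrame) (M.starAssignment v) a i (M.star x) := by
  funext b j
  by_cases hb : b = a
  · subst hb
    by_cases hj : j = i
    · subst hj
      simp [starAssignment, Frame.Assignment.set_self, stdSet_self]
    · simp [starAssignment, Frame.Assignment.set_ne _ _ _ _ _ _ hj, stdSet_ne _ _ _ _ _ _ hj]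
  · have h1 : Frame.Assignment.set (M := stdFrame) v a i x b = v b := Function.update_of_ne hb _ _
    have h2 : (M.starAssignment v).set a i (M.star x) b = M.starAssignment v b :=
      Function.update_of_ne hb _ _
    rw [h2]
    simp only [starAssignment, stdSet, h1]

theorem stdSat_iff_sat (φ : Fml) (v : ∀ a : Ty, ℕ → Std a) :
    StdSat φ v ↔ M.toFrame.Sat φ (M.starAssignment v) :=
  (stdSat_iff φ v).trans (M.transfer φ v)

theorem mem_star_star (x : Std a) (S : Set (Std a)) :
    M.mem (M.star x) (M.star (a := Ty.pow a) S) ↔ x ∈ S := by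
  simpa [starAssignment_stdSet, Frame.Sat, Frame.Assignment.set_self, Frame.Assignment.set_ne,
    StdSat, stdSet_self, stdSet_ne] using (M.stdSat_iff_sat (Fml.mem a 0 1)
    (stdSet (stdSet baseAssignment a 0 x) (Ty.pow a) 1 S)).symm

theorem star_pair (x : Std a) (y : Std b) :
    M.star (a := Ty.prod a b) (x, y) = M.pair (M.star x) (M.star y) := by
  simpa [starAssignment_stdSet, Frame.Sat, Frame.Assignment.set_self, Frame.Assignment.set_ne,
    StdSat, stdSet_self, stdSet_ne] using (M.stdSat_iff_sat (Fml.pair a b 0 1 2)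
    (stdSet (stdSet (stdSet baseAssignment a 0 x) b 1 y) (Ty.prod a b) 2 (x, y)))

theorem mem_star_univ (x : M.D a) : M.mem x (M.star (a := Ty.pow a) Set.univ) := by
  have h := M.stdSat_iff_sat (Fml.all a 0 (Fml.mem a 0 1))
    (stdSet baseAssignment (Ty.pow a) 1 (Set.univ : Set (Std a)))
  simp [starAssignment_stdSet, Frame.Sat, Frame.Assignment.set_self, Frame.Assignment.set_ne,
    StdSat, stdSet_self, stdSet_ne] at h
  exact h x

theorem mem_star_compl (x : M.D a) (S : Set (Std a)) :
    M.mem x (M.star (a := Ty.pow a) Sᶜ) ↔ ¬ M.mem x (M.star (a := Ty.pow a) S) := by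
  have h := M.stdSat_iff_sat (Fml.all a 0 (Fml.and
    (Fml.neg (Fml.and (Fml.mem a 0 1) (Fml.mem a 0 2)))
    (Fml.neg (Fml.and (Fml.neg (Fml.mem a 0 1)) (Fml.neg (Fml.mem a 0 2))))))
    (stdSet (stdSet baseAssignment (Ty.pow a) 1 S) (Ty.pow a) 2 (Sᶜ : Set (Std a)))
  simp [starAssignment_stdSet, Frame.Sat, Frame.Assignment.set_self, Frame.Assignment.set_ne,
    StdSat, stdSet_self, stdSet_ne] at h
  have := h x
  tauto

theorem mem_star_inter (x : M.D a) (S T : Set (Std a)) :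
    M.mem x (M.star (a := Ty.pow a) (S ∩ T)) ↔
      M.mem x (M.star (a := Ty.pow a) S) ∧ M.mem x (M.star (a := Ty.pow a) T) := by
  have h := (M.stdSat_iff_sat (Fml.all a 0 (Fml.and
    (Fml.neg (Fml.and (Fml.and (Fml.mem a 0 1) (Fml.mem a 0 2)) (Fml.neg (Fml.mem a 0 3))))
    (Fml.neg (Fml.and (Fml.mem a 0 3) (Fml.neg (Fml.and (Fml.mem a 0 1) (Fml.mem a 0 2)))))))
    (stdSet (stdSet (stdSet baseAssignment (Ty.pow a) 1 S) (Ty.pow a) 2 T) (Ty.pow a) 3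
      (S ∩ T : Set (Std a)))).1
  simp [starAssignment_stdSet, Frame.Sat, Frame.Assignment.set_self, Frame.Assignment.set_ne,
    StdSat, stdSet_self, stdSet_ne] at h
  have := h x
  tauto

/-- The transfer of `∀ x y, (x, y) ∈ F → (x ∈ S ↔ y ∈ T)`. -/
theorem transfer_mem_iff (F : Set (Std a × Std b)) (S : Set (Std a)) (T : Set (Std b))
    (h : ∀ x y, (x, y) ∈ F → (x ∈ S ↔ y ∈ T)) {x : M.D a} {y : M.D b}
    (hxy : M.mem (M.pair x y) (M.star (a := Ty.pow (Ty.prod a b)) F)) :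
    M.mem x (M.star (a := Ty.pow a) S) ↔ M.mem y (M.star (a := Ty.pow b) T) := by
  have h' := (M.stdSat_iff_sat (Fml.all a 0 (Fml.all b 1 (Fml.all (Ty.prod a b) 2 (Fml.neg
    (Fml.and (Fml.and (Fml.pair a b 0 1 2) (Fml.mem (Ty.prod a b) 2 3))
      (Fml.neg (Fml.and
        (Fml.neg (Fml.and (Fml.mem a 0 4) (Fml.neg (Fml.mem b 1 5))))
        (Fml.neg (Fml.and (Fml.mem b 1 5) (Fml.neg (Fml.mem a 0 4)))))))))))
    (stdSet (stdSet (stdSet baseAssignment (Ty.pow (Ty.prod a b)) 3 F) (Ty.pow a) 4 S)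
      (Ty.pow b) 5 T)).1
  simp [starAssignment_stdSet, Frame.Sat, Frame.Assignment.set_self, Frame.Assignment.set_ne,
    StdSat, stdSet_self, stdSet_ne, -Prod.forall] at h'
  have := h' (fun x y hF => ⟨(h x y hF).1, (h x y hF).2⟩) x y hxy
  tauto

/-- The transfer of `∀ x y z, (x, y) ∈ F → (y, z) ∈ G → (x, z) ∈ H`. -/
theorem transfer_comp (F : Set (Std a × Std b)) (G : Set (Std b × Std c)) (H : Set (Std a × Std c))
    (h : ∀ x y z, (x, y) ∈ F → (y, z) ∈ G → (x, z) ∈ H) {x : M.D a} {y : M.D b} {z : M.D c}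
    (hxy : M.mem (M.pair x y) (M.star (a := Ty.pow (Ty.prod a b)) F))
    (hyz : M.mem (M.pair y z) (M.star (a := Ty.pow (Ty.prod b c)) G)) :
    M.mem (M.pair x z) (M.star (a := Ty.pow (Ty.prod a c)) H) := by
  have h' := (M.stdSat_iff_sat (Fml.all a 0 (Fml.all b 1 (Fml.all c 2 (Fml.all (Ty.prod a b) 3
    (Fml.all (Ty.prod b c) 4 (Fml.all (Ty.prod a c) 5 (Fml.neg
    (Fml.and (Fml.and (Fml.pair a b 0 1 3) (Fml.mem (Ty.prod a b) 3 6))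
    (Fml.and (Fml.and (Fml.pair b c 1 2 4) (Fml.mem (Ty.prod b c) 4 7))
    (Fml.and (Fml.pair a c 0 2 5) (Fml.neg (Fml.mem (Ty.prod a c) 5 8))))))))))))
    (stdSet (stdSet (stdSet baseAssignment (Ty.pow (Ty.prod a b)) 6 F)
      (Ty.pow (Ty.prod b c)) 7 G) (Ty.pow (Ty.prod a c)) 8 H)).1
  simp [starAssignment_stdSet, Frame.Sat, Frame.Assignment.set_self, Frame.Assignment.set_ne,
    StdSat, stdSet_self, stdSet_ne, -Prod.forall] at h'
  exact h' (by rintro x y z _ _ _ rfl hF rfl hG rfl; exact h x y z hF hG) x y z _ _ _ rfl hxy rfl hyz rfl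

/-- The transfer of `∀ x y z w, (x, y) ∈ F → (x, z) ∈ G → w = (y, z) → (x, w) ∈ H`. -/
theorem transfer_pair (F : Set (Std a × Std b)) (G : Set (Std a × Std c))
    (H : Set (Std a × (Std b × Std c)))
    (h : ∀ x y z, (x, y) ∈ F → (x, z) ∈ G → (x, (y, z)) ∈ H) {x : M.D a} {y : M.D b} {z : M.D c}
    (hxy : M.mem (M.pair x y) (M.star (a := Ty.pow (Ty.prod a b)) F))
    (hxz : M.mem (M.pair x z) (M.star (a := Ty.pow (Ty.prod a c)) G)) :
    M.mem (M.pair x (M.pair y z)) (M.star (a := Ty.pow (Ty.prod a (Ty.prod b c))) H) := by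
  have h' := (M.stdSat_iff_sat (Fml.all a 0 (Fml.all b 1 (Fml.all c 2 (Fml.all (Ty.prod a b) 3
    (Fml.all (Ty.prod a c) 4 (Fml.all (Ty.prod b c) 5 (Fml.all (Ty.prod a (Ty.prod b c)) 6 (Fml.neg
    (Fml.and (Fml.and (Fml.pair a b 0 1 3) (Fml.mem (Ty.prod a b) 3 7))
    (Fml.and (Fml.and (Fml.pair a c 0 2 4) (Fml.mem (Ty.prod a c) 4 8))
    (Fml.and (Fml.and (Fml.pair b c 1 2 5) (Fml.pair a (Ty.prod b c) 0 5 6))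
      (Fml.neg (Fml.mem (Ty.prod a (Ty.prod b c)) 6 9)))))))))))))
    (stdSet (stdSet (stdSet baseAssignment (Ty.pow (Ty.prod a b)) 7 F)
      (Ty.pow (Ty.prod a c)) 8 G) (Ty.pow (Ty.prod a (Ty.prod b c))) 9 H)).1
  simp [starAssignment_stdSet, Frame.Sat, Frame.Assignment.set_self, Frame.Assignment.set_ne,
    StdSat, stdSet_self, stdSet_ne, -Prod.forall] at h'
  exact h' (by rintro x y z _ _ _ _ rfl hF rfl hG rfl rfl; exact h x y z hF hG)
    x y z _ _ _ _ rfl hxy rfl hxz rfl rfl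

/-- The transfer of `∀ x y Y, (x, y) ∈ F → (x, Y) ∈ G → (x ∈ S ↔ y ∈ Y)`. -/
theorem transfer_mem_mem (F : Set (Std a × Std b)) (G : Set (Std a × Set (Std b)))
    (S : Set (Std a)) (h : ∀ x y Y, (x, y) ∈ F → (x, Y) ∈ G → (x ∈ S ↔ y ∈ Y))
    {x : M.D a} {y : M.D b} {Y : M.D (Ty.pow b)}
    (hxy : M.mem (M.pair x y) (M.star (a := Ty.pow (Ty.prod a b)) F))
    (hxY : M.mem (M.pair x Y) (M.star (a := Ty.pow (Ty.prod a (Ty.pow b))) G)) :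
    M.mem x (M.star (a := Ty.pow a) S) ↔ M.mem y Y := by
  have h' := (M.stdSat_iff_sat (Fml.all a 0 (Fml.all b 1 (Fml.all (Ty.pow b) 2
    (Fml.all (Ty.prod a b) 3 (Fml.all (Ty.prod a (Ty.pow b)) 4 (Fml.neg
    (Fml.and (Fml.and (Fml.pair a b 0 1 3) (Fml.mem (Ty.prod a b) 3 5))
    (Fml.and (Fml.and (Fml.pair a (Ty.pow b) 0 2 4) (Fml.mem (Ty.prod a (Ty.pow b)) 4 6))
      (Fml.neg (Fml.and
        (Fml.neg (Fml.and (Fml.mem a 0 7) (Fml.neg (Fml.mem b 1 2))))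
        (Fml.neg (Fml.and (Fml.mem b 1 2) (Fml.neg (Fml.mem a 0 7))))))))))))))
    (stdSet (stdSet (stdSet baseAssignment (Ty.pow (Ty.prod a b)) 5 F)
      (Ty.pow (Ty.prod a (Ty.pow b))) 6 G) (Ty.pow a) 7 S)).1
  simp [starAssignment_stdSet, Frame.Sat, Frame.Assignment.set_self, Frame.Assignment.set_ne,
    StdSat, stdSet_self, stdSet_ne, -Prod.forall] at h'
  have := h' (by
    rintro x y Y _ _ rfl hF rfl hG
    exact ⟨(h x y Y hF hG).1, (h x y Y hF hG).2⟩) x y Y _ _ rfl hxy rfl hxY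
  tauto

/-- The transfer of `∀ x y z, (x, y) ∈ F → (x, z) ∈ G → (x ∈ S ↔ y = z)`. -/
theorem transfer_mem_eq (F G : Set (Std a × Std b)) (S : Set (Std a))
    (h : ∀ x y z, (x, y) ∈ F → (x, z) ∈ G → (x ∈ S ↔ y = z)) {x : M.D a} {y z : M.D b}
    (hxy : M.mem (M.pair x y) (M.star (a := Ty.pow (Ty.prod a b)) F))
    (hxz : M.mem (M.pair x z) (M.star (a := Ty.pow (Ty.prod a b)) G)) :
    M.mem x (M.star (a := Ty.pow a) S) ↔ y = z := by
  have h' := (M.stdSat_iff_sat (Fml.all a 0 (Fml.all b 1 (Fml.all b 2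
    (Fml.all (Ty.prod a b) 3 (Fml.all (Ty.prod a b) 4 (Fml.neg
    (Fml.and (Fml.and (Fml.pair a b 0 1 3) (Fml.mem (Ty.prod a b) 3 5))
    (Fml.and (Fml.and (Fml.pair a b 0 2 4) (Fml.mem (Ty.prod a b) 4 6))
      (Fml.neg (Fml.and
        (Fml.neg (Fml.and (Fml.mem a 0 7) (Fml.neg (Fml.eq b 1 2))))
        (Fml.neg (Fml.and (Fml.eq b 1 2) (Fml.neg (Fml.mem a 0 7))))))))))))))
    (stdSet (stdSet (stdSet baseAssignment (Ty.pow (Ty.prod a b)) 5 F)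
      (Ty.pow (Ty.prod a b)) 6 G) (Ty.pow a) 7 S)).1
  simp [starAssignment_stdSet, Frame.Sat, Frame.Assignment.set_self, Frame.Assignment.set_ne,
    StdSat, stdSet_self, stdSet_ne, -Prod.forall] at h'
  have := h' (by
    rintro x y Y _ _ rfl hF rfl hG
    exact ⟨(h x y Y hF hG).1, (h x y Y hF hG).2⟩) x y z _ _ rfl hxy rfl hxz
  tauto

/-- The transfer of `∀ x, (x, s) ∈ F`. -/
theorem transfer_const (F : Set (Std a × Std b)) (s : Std b)
    (h : ∀ x, (x, s) ∈ F) (x : M.D a) :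
    M.mem (M.pair x (M.star s)) (M.star (a := Ty.pow (Ty.prod a b)) F) := by
  have h' := (M.stdSat_iff_sat (Fml.all a 0 (Fml.all (Ty.prod a b) 1
    (Fml.neg (Fml.and (Fml.pair a b 0 2 1) (Fml.neg (Fml.mem (Ty.prod a b) 1 3))))))
    (stdSet (stdSet baseAssignment b 2 s) (Ty.pow (Ty.prod a b)) 3 F)).1
  simp [starAssignment_stdSet, Frame.Sat, Frame.Assignment.set_self, Frame.Assignment.set_ne,
    StdSat, stdSet_self, stdSet_ne, -Prod.forall] at h'
  exact h' h x

/-- The transfer of `∀ x, (x, x) ∈ F`. -/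
theorem transfer_diag (F : Set (Std a × Std a))
    (h : ∀ x, (x, x) ∈ F) (x : M.D a) :
    M.mem (M.pair x x) (M.star (a := Ty.pow (Ty.prod a a)) F) := by
  have h' := (M.stdSat_iff_sat (Fml.all a 0 (Fml.all (Ty.prod a a) 1
    (Fml.neg (Fml.and (Fml.pair a a 0 0 1) (Fml.neg (Fml.mem (Ty.prod a a) 1 2))))))
    (stdSet baseAssignment (Ty.pow (Ty.prod a a)) 2 F)).1
  simp [starAssignment_stdSet, Frame.Sat, Frame.Assignment.set_self, Frame.Assignment.set_ne,
    StdSat, stdSet_self, stdSet_ne, -Prod.forall] at h'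
  exact h' h x

theorem exists_eq_pair (z : M.D (Ty.prod a b)) : ∃ x y, z = M.pair x y := by
  have h' := (M.stdSat_iff_sat (Fml.all (Ty.prod a b) 0 (Fml.neg (Fml.all a 1 (Fml.all b 2
    (Fml.neg (Fml.pair a b 1 2 0)))))) baseAssignment).1
  simp [Frame.Sat, Frame.Assignment.set_self, Frame.Assignment.set_ne,
    StdSat, stdSet_self, stdSet_ne, -Prod.forall] at h'
  exact h' (fun z => ⟨z.1, z.2, rfl⟩) z

/-- The transfer of `∀ x y, ((x, y), x) ∈ F`. -/
theorem transfer_fst (F : Set ((Std a × Std b) × Std a)) (h : ∀ x y, ((x, y), x) ∈ F)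
    (x : M.D a) (y : M.D b) :
    M.mem (M.pair (M.pair x y) x) (M.star (a := Ty.pow (Ty.prod (Ty.prod a b) a)) F) := by
  have h' := (M.stdSat_iff_sat (Fml.all a 0 (Fml.all b 1 (Fml.all (Ty.prod a b) 2
    (Fml.all (Ty.prod (Ty.prod a b) a) 3 (Fml.neg
    (Fml.and (Fml.and (Fml.pair a b 0 1 2) (Fml.pair (Ty.prod a b) a 2 0 3))
      (Fml.neg (Fml.mem (Ty.prod (Ty.prod a b) a) 3 4))))))))
    (stdSet baseAssignment (Ty.pow (Ty.prod (Ty.prod a b) a)) 4 F)).1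
  simp [starAssignment_stdSet, Frame.Sat, Frame.Assignment.set_self, Frame.Assignment.set_ne,
    StdSat, stdSet_self, stdSet_ne, -Prod.forall] at h'
  exact h' h x y

/-- The transfer of `∀ x y, ((x, y), y) ∈ F`. -/
theorem transfer_snd (F : Set ((Std a × Std b) × Std b)) (h : ∀ x y, ((x, y), y) ∈ F)
    (x : M.D a) (y : M.D b) :
    M.mem (M.pair (M.pair x y) y) (M.star (a := Ty.pow (Ty.prod (Ty.prod a b) b)) F) := by
  have h' := (M.stdSat_iff_sat (Fml.all a 0 (Fml.all b 1 (Fml.all (Ty.prod a b) 2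
    (Fml.all (Ty.prod (Ty.prod a b) b) 3 (Fml.neg
    (Fml.and (Fml.and (Fml.pair a b 0 1 2) (Fml.pair (Ty.prod a b) b 2 1 3))
      (Fml.neg (Fml.mem (Ty.prod (Ty.prod a b) b) 3 4))))))))
    (stdSet baseAssignment (Ty.pow (Ty.prod (Ty.prod a b) b)) 4 F)).1
  simp [starAssignment_stdSet, Frame.Sat, Frame.Assignment.set_self, Frame.Assignment.set_ne,
    StdSat, stdSet_self, stdSet_ne, -Prod.forall] at h'
  exact h' h x y

/-- The ultrafilter on the standard objects determined by an internal object `x`: the sets `S`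
with `x ∈ *S`. -/
def ultra (x : M.D a) : Ultrafilter (Std a) :=
  Ultrafilter.ofComplNotMemIff
    { sets := {S | M.mem x (M.star (a := Ty.pow a) S)}
      univ_sets := M.mem_star_univ x
      sets_of_superset := by
        intro S T hS hST
        have : S = S ∩ T := (Set.inter_eq_left.2 hST).symm
        rw [this] at hS
        exact ((M.mem_star_inter x S T).1 hS).2
      inter_sets := fun hS hT => (M.mem_star_inter x _ _).2 ⟨hS, hT⟩ }
    (by
      intro S
      change ¬ M.mem x (M.star (a := Ty.pow a) Sᶜ) ↔ M.mem x (M.star (a := Ty.pow a) S)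
      rw [mem_star_compl, not_not])

theorem starFun_spec (f : Std a → Std b) (x : M.D a) :
    M.mem (M.pair x (M.starFun f x)) (M.star (a := Ty.pow (Ty.prod a b)) {p | p.2 = f p.1}) :=
  (M.existsUnique_starFun f x).choose_spec.1

theorem starFun_eq {f : Std a → Std b} {x : M.D a} {y : M.D b}
    (h : M.mem (M.pair x y) (M.star (a := Ty.pow (Ty.prod a b)) {p | p.2 = f p.1})) :
    M.starFun f x = y :=
  (M.existsUnique_starFun f x).unique (M.starFun_spec f x) h

theorem starFun_star (f : Std a → Std b) (x : Std a) :
    M.starFun f (M.star x) = M.star (f x) := by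
  apply M.starFun_eq
  rw [← star_pair, mem_star_star]
  rfl

theorem mem_star_preimage (f : Std a → Std b) (x : M.D a) (S : Set (Std b)) :
    M.mem x (M.star (a := Ty.pow a) (f ⁻¹' S)) ↔
      M.mem (M.starFun f x) (M.star (a := Ty.pow b) S) :=
  M.transfer_mem_iff _ _ _ (by rintro x y (rfl : y = f x); rfl) (M.starFun_spec f x)

theorem ultra_starFun (f : Std a → Std b) (x : M.D a) :
    (M.ultra (M.starFun f x) : Filter (Std b)) = Filter.map f (M.ultra x) := by
  ext S
  exact (M.mem_star_preimage f x S).symm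

theorem starFun_starFun (g : Std b → Std c) (f : Std a → Std b) (x : M.D a) :
    M.starFun g (M.starFun f x) = M.starFun (fun t => g (f t)) x :=
  (M.starFun_eq (M.transfer_comp _ _ _
    (by rintro x y z (rfl : y = f x) (rfl : z = g (f x)); rfl)
    (M.starFun_spec f x) (M.starFun_spec g _))).symm

theorem pair_starFun (f : Std a → Std b) (g : Std a → Std c) (x : M.D a) :
    M.pair (M.starFun f x) (M.starFun g x) =
      M.starFun (b := Ty.prod b c) (fun t => (f t, g t)) x :=
  (M.starFun_eq (b := Ty.prod b c) (M.transfer_pair _ _ _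
    (by rintro x y z (rfl : y = f x) (rfl : z = g x); rfl)
    (M.starFun_spec f x) (M.starFun_spec g x))).symm

/-- Łoś's theorem for membership; `starFun_eq_starFun_iff` and `starRel_starFun` are the versions
for equality and for standard relations. -/
theorem mem_starFun_iff (f : Std a → Std b) (A : Std a → Set (Std b)) (x : M.D a) :
    M.mem (M.starFun f x) (M.starFun (b := Ty.pow b) A x) ↔ ∀ᶠ t in M.ultra x, f t ∈ A t :=
  (M.transfer_mem_mem _ _ _ (by rintro x y z (rfl : y = f x) (rfl : z = A x); rfl)
    (M.starFun_spec f x) (M.starFun_spec (b := Ty.pow b) A x)).symm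

theorem starFun_eq_starFun_iff (f g : Std a → Std b) (x : M.D a) :
    M.starFun f x = M.starFun g x ↔ ∀ᶠ t in M.ultra x, f t = g t :=
  (M.transfer_mem_eq _ _ _ (by rintro x y z (rfl : y = f x) (rfl : z = g x); rfl)
    (M.starFun_spec f x) (M.starFun_spec g x)).symm

theorem starFun_const (s : Std b) (x : M.D a) : M.starFun (fun _ => s) x = M.star s :=
  M.starFun_eq (M.transfer_const _ _ (fun _ => rfl) x)

theorem starFun_id (x : M.D a) : M.starFun (fun t => t) x = x :=
  M.starFun_eq (M.transfer_diag _ (fun _ => rfl) x)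

/-- The first component of an internal pair. -/
noncomputable def fst (z : M.D (Ty.prod a b)) : M.D a :=
  M.starFun (a := Ty.prod a b) (b := a) (fun p : Std a × Std b => p.1) z

/-- The second component of an internal pair. -/
noncomputable def snd (z : M.D (Ty.prod a b)) : M.D b :=
  M.starFun (a := Ty.prod a b) (b := b) (fun p : Std a × Std b => p.2) z

@[simp] theorem fst_pair (x : M.D a) (y : M.D b) : M.fst (M.pair x y) = x :=
  M.starFun_eq (a := Ty.prod a b) (M.transfer_fst _ (fun _ _ => rfl) x y)

@[simp] theorem snd_pair (x : M.D a) (y : M.D b) : M.snd (M.pair x y) = y :=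
  M.starFun_eq (a := Ty.prod a b) (M.transfer_snd _ (fun _ _ => rfl) x y)

@[simp] theorem pair_fst_snd (z : M.D (Ty.prod a b)) : M.pair (M.fst z) (M.snd z) = z := by
  obtain ⟨x, y, rfl⟩ := M.exists_eq_pair z
  simp

theorem eq_pair_iff {z : M.D (Ty.prod a b)} {x : M.D a} {y : M.D b} :
    z = M.pair x y ↔ M.fst z = x ∧ M.snd z = y := by
  constructor
  · rintro rfl
    simp
  · rintro ⟨rfl, rfl⟩
    simp

/-- The pair `(x, y)` serves as a common parameter. Any finite list of internal objects thus
consists of values of standard functions at one `t`, and relations between them become statements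
about `ultra t`-almost all standard `s`. Later arguments use this in place of transfer of formulas.
-/
theorem exists_starFun₂ (x : M.D a) (y : M.D b) : ∃ (e : Ty) (t : M.D e)
    (f : Std e → Std a) (g : Std e → Std b), x = M.starFun f t ∧ y = M.starFun g t :=
  ⟨Ty.prod a b, M.pair x y, fun p : Std a × Std b => p.1, fun p : Std a × Std b => p.2,
    (M.fst_pair x y).symm, (M.snd_pair x y).symm⟩

theorem exists_starFun₃ (x : M.D a) (y : M.D b) (z : M.D c) : ∃ (e : Ty) (t : M.D e)
    (f : Std e → Std a) (g : Std e → Std b) (h : Std e → Std c),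
    x = M.starFun f t ∧ y = M.starFun g t ∧ z = M.starFun h t := by
  obtain ⟨e, t, f, g, rfl, rfl⟩ := M.exists_starFun₂ x y
  obtain ⟨e', t', f', g', rfl, rfl⟩ := M.exists_starFun₂ t z
  exact ⟨e', t', _, _, _, M.starFun_starFun _ _ _, M.starFun_starFun _ _ _, rfl⟩

theorem starRel_starFun (R : Std b → Std c → Prop) (f : Std a → Std b) (g : Std a → Std c)
    (x : M.D a) :
    M.starRel R (M.starFun f x) (M.starFun g x) ↔ ∀ᶠ t in M.ultra x, R (f t) (g t) := by
  unfold starRel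
  rw [pair_starFun]
  exact (M.mem_star_preimage (b := Ty.prod b c) (fun t => (f t, g t)) x {p | R p.1 p.2}).symm

theorem le_starFun (f g : Std a → ℕ) (x : M.D a) :
    M.le (M.starFun (b := Ty.nat) f x) (M.starFun (b := Ty.nat) g x) ↔
      ∀ᶠ t in M.ultra x, f t ≤ g t :=
  M.starRel_starFun (b := Ty.nat) (c := Ty.nat) _ f g x

theorem lt_starFun (f g : Std a → ℕ) (x : M.D a) :
    M.lt (M.starFun (b := Ty.nat) f x) (M.starFun (b := Ty.nat) g x) ↔
      ∀ᶠ t in M.ultra x, f t < g t :=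
  M.starRel_starFun (b := Ty.nat) (c := Ty.nat) _ f g x

theorem add_starFun (f g : Std a → ℕ) (x : M.D a) :
    M.add (M.starFun (b := Ty.nat) f x) (M.starFun (b := Ty.nat) g x) =
      M.starFun (b := Ty.nat) (fun t => f t + g t) x := by
  unfold add
  rw [pair_starFun]
  exact M.starFun_starFun (b := Ty.prod Ty.nat Ty.nat) (c := Ty.nat) _ _ _

theorem mul_starFun (f g : Std a → ℕ) (x : M.D a) :
    M.mul (M.starFun (b := Ty.nat) f x) (M.starFun (b := Ty.nat) g x) =
      M.starFun (b := Ty.nat) (fun t => f t * g t) x := by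
  unfold mul
  rw [pair_starFun]
  exact M.starFun_starFun (b := Ty.prod Ty.nat Ty.nat) (c := Ty.nat) _ _ _

theorem ratio_starFun (f g : Std a → ℕ) (x : M.D a) :
    M.ratio (M.starFun (b := Ty.nat) f x) (M.starFun (b := Ty.nat) g x) =
      M.starFun (b := Ty.real) (fun t => (f t : ℝ) / (g t : ℝ)) x := by
  unfold ratio
  rw [pair_starFun]
  exact M.starFun_starFun (b := Ty.prod Ty.nat Ty.nat) (c := Ty.real) _ _ _

end Transfer

/-! ### Closure properties of internal, countably determined and Borel sets. -/

section Internal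

variable (M : NonstandardUniverse.{u}) {a b c : Ty}

theorem mem_iff_starRel (x : M.D a) (A : M.D (Ty.pow a)) :
    M.mem x A ↔ M.starRel (b := Ty.pow a) (fun (s : Std a) (S : Set (Std a)) => s ∈ S) x A := by
  obtain ⟨e, t, f, g, rfl, rfl⟩ := M.exists_starFun₂ x A
  rw [starRel_starFun]
  exact M.mem_starFun_iff f g t

theorem mem_starFun_pow_iff (F : Std b → Set (Std a)) (x : M.D a) (p : M.D b) :
    M.mem x (M.starFun (b := Ty.pow a) F p) ↔ M.starRel (fun s t => s ∈ F t) x p := by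
  obtain ⟨e, t, f, g, rfl, rfl⟩ := M.exists_starFun₂ x p
  rw [starRel_starFun, starFun_starFun]
  exact M.mem_starFun_iff f _ t

/-- Sets that are defined from an internal parameter are internal. -/
theorem isInternal_starRel (R : Std a → Std b → Prop) (p : M.D b) :
    M.IsInternal {x : M.D a | M.starRel R x p} :=
  ⟨M.starFun (b := Ty.pow a) (fun t => {s | R s t}) p,
    Set.ext fun x => (M.mem_starFun_pow_iff (fun t => {s | R s t}) x p).symm⟩

theorem isInternal_eventually (p : Std a → Prop) :
    M.IsInternal {x : M.D a | ∀ᶠ t in M.ultra x, p t} :=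
  ⟨M.star (a := Ty.pow a) {t | p t}, rfl⟩

theorem mem_ext (x : M.D a) (A : M.D (Ty.pow a)) : x ∈ M.ext A ↔ M.mem x A :=
  Iff.rfl

variable {M}

theorem IsInternal.preimage {Y : Set (M.D b)} (hY : M.IsInternal Y) (f : Std a → Std b) :
    M.IsInternal (M.starFun f ⁻¹' Y) := by
  obtain ⟨A, rfl⟩ := hY
  convert M.isInternal_starRel (b := Ty.pow b) (fun (s : Std a) (S : Set (Std b)) => f s ∈ S) A
    using 1
  ext x
  rw [Set.mem_preimage, mem_ext, Set.mem_ofPred_eq]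
  obtain ⟨e, t, g, S, rfl, rfl⟩ := M.exists_starFun₂ x A
  rw [starFun_starFun, starRel_starFun]
  exact M.mem_starFun_iff _ S t

theorem IsInternal.compl {Y : Set (M.D a)} (hY : M.IsInternal Y) : M.IsInternal Yᶜ := by
  obtain ⟨A, rfl⟩ := hY
  convert M.isInternal_starRel (b := Ty.pow a) (fun (s : Std a) (S : Set (Std a)) => s ∉ S) A
    using 1
  ext x
  rw [Set.mem_compl_iff, mem_ext, Set.mem_ofPred_eq]
  rw [mem_iff_starRel]
  obtain ⟨e, t, g, S, rfl, rfl⟩ := M.exists_starFun₂ x A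
  rw [starRel_starFun, starRel_starFun, Ultrafilter.eventually_not]

theorem IsInternal.inter {Y Z : Set (M.D a)} (hY : M.IsInternal Y) (hZ : M.IsInternal Z) :
    M.IsInternal (Y ∩ Z) := by
  obtain ⟨A, rfl⟩ := hY
  obtain ⟨B, rfl⟩ := hZ
  convert M.isInternal_starRel (b := Ty.prod (Ty.pow a) (Ty.pow a))
    (fun (s : Std a) (S : Set (Std a) × Set (Std a)) => s ∈ S.1 ∩ S.2) (M.pair A B) using 1
  ext x
  rw [Set.mem_inter_iff, mem_ext, mem_ext, Set.mem_ofPred_eq]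
  obtain ⟨e, t, g, S, T, rfl, rfl, rfl⟩ := M.exists_starFun₃ x A B
  rw [pair_starFun, starRel_starFun]
  refine (and_congr (M.mem_starFun_iff g S t) (M.mem_starFun_iff g T t)).trans ?_
  exact eventually_and.symm

theorem isInternal_univ : M.IsInternal (Set.univ : Set (M.D a)) := by
  convert M.isInternal_eventually (a := a) fun _ => True
  simp

theorem isInternal_empty : M.IsInternal (∅ : Set (M.D a)) := by
  simpa using (isInternal_univ (M := M) (a := a)).compl

theorem IsInternal.union {Y Z : Set (M.D a)} (hY : M.IsInternal Y) (hZ : M.IsInternal Z) :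
    M.IsInternal (Y ∪ Z) := by
  simpa [Set.compl_inter] using (hY.compl.inter hZ.compl).compl

theorem isInternal_biInter_lt {Y : ℕ → Set (M.D a)} (hY : ∀ n, M.IsInternal (Y n)) (k : ℕ) :
    M.IsInternal (⋂ i < k, Y i) := by
  induction k with
  | zero => simpa using isInternal_univ
  | succ k ih =>
    rw [Set.biInter_lt_succ]
    exact ih.inter (hY k)

/-- Saturation, for internal sets. -/
theorem exists_mem_iInter {Y : ℕ → Set (M.D a)} (hY : ∀ n, M.IsInternal (Y n))
    (h : ∀ n, (⋂ i < n, Y i).Nonempty) : (⋂ i, Y i).Nonempty := by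
  choose A hA using hY
  obtain ⟨x, hx⟩ := M.saturated a A fun n => by
    obtain ⟨x, hx⟩ := h n
    refine ⟨x, fun i hi => ?_⟩
    have := Set.mem_iInter₂.1 hx i hi
    rwa [hA] at this
  refine ⟨x, Set.mem_iInter.2 fun i => ?_⟩
  rw [hA]
  exact hx i

theorem isInternal_singleton (x : M.D a) : M.IsInternal ({x} : Set (M.D a)) := by
  convert M.isInternal_starRel (fun s t : Std a => s = t) x using 1
  ext y
  obtain ⟨e, t, f, g, rfl, rfl⟩ := M.exists_starFun₂ y x
  rw [Set.mem_ofPred_eq, starRel_starFun, Set.mem_singleton_iff, starFun_eq_starFun_iff]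

/-- A set is countably determined as soon as membership in it only depends on membership in
countably many internal sets. -/
theorem isCD_of_forall {ι : Type*} [Countable ι] {X : Set (M.D a)} (Y : ι → Set (M.D a))
    (hY : ∀ i, M.IsInternal (Y i))
    (h : ∀ z z', (∀ i, z ∈ Y i ↔ z' ∈ Y i) → z ∈ X → z' ∈ X) : M.IsCD X := by
  -- The extra index stands for the full set. It makes the union of the family everything, so the
  -- relative complements in the definition are true complements, and it allows `ι` to be empty.
  obtain ⟨e, he⟩ := exists_surjective_nat (Option ι)
  let Z : Option ι → Set (M.D a) := fun o => o.elim Set.univ Y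
  have hZ : ∀ o, M.IsInternal (Z o) := by
    rintro (_ | i)
    exacts [isInternal_univ, hY i]
  refine ⟨fun n => Z (e n), {s | ∃ z ∈ X, s = {n | z ∈ Z (e n)}}, fun n => hZ _, ?_⟩
  have huniv : ∀ z, z ∈ ⋃ n, Z (e n) := by
    intro z
    obtain ⟨n, hn⟩ := he none
    exact Set.mem_iUnion.2 ⟨n, by rw [hn]; trivial⟩
  ext z
  simp only [Set.mem_iUnion, Set.mem_inter_iff, Set.mem_iInter, exists_prop]
  constructor
  · intro hz
    exact ⟨_, ⟨z, hz, rfl⟩, fun n hn => hn, fun n hn => ⟨by simpa using huniv z, hn⟩⟩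
  · rintro ⟨_, ⟨z', hz', rfl⟩, h1, h2⟩
    refine h z' z (fun i => ?_) hz'
    obtain ⟨n, hn⟩ := he (some i)
    have h1' := h1 n
    have h2' := h2 n
    simp only [hn, Set.mem_ofPred_eq, Set.mem_compl_iff] at h1' h2'
    exact ⟨h1', fun hz => by_contra fun h3 => (h2' h3).2 hz⟩

/-- The converse of `isCD_of_forall`: CD sets are the unions of atoms of a countable family of
internal sets. The closure properties are proved through this description. -/
theorem IsCD.exists_forall {X : Set (M.D a)} (hX : M.IsCD X) :
    ∃ Y : ℕ → Set (M.D a), (∀ m, M.IsInternal (Y m)) ∧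
      ∀ z z', (∀ m, z ∈ Y m ↔ z' ∈ Y m) → z ∈ X → z' ∈ X := by
  obtain ⟨Y, B, hY, rfl⟩ := hX
  refine ⟨Y, hY, fun z z' h hz => ?_⟩
  simpa [h] using hz

theorem IsInternal.isCD {X : Set (M.D a)} (hX : M.IsInternal X) : M.IsCD X :=
  isCD_of_forall (fun _ : Unit => X) (fun _ => hX) fun _ _ h => (h ()).1

theorem IsCD.compl {X : Set (M.D a)} (hX : M.IsCD X) : M.IsCD Xᶜ := by
  obtain ⟨Y, hY, h⟩ := hX.exists_forall
  exact isCD_of_forall Y hY fun z z' hz hz' h' => hz' (h z' z (fun m => (hz m).symm) h')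

theorem IsCD.iUnion {ι : Type*} [Countable ι] {X : ι → Set (M.D a)} (hX : ∀ i, M.IsCD (X i)) :
    M.IsCD (⋃ i, X i) := by
  choose Y hY h using fun i => (hX i).exists_forall
  refine isCD_of_forall (fun p : ι × ℕ => Y p.1 p.2) (fun p => hY _ _) fun z z' hz hz' => ?_
  obtain ⟨i, hi⟩ := Set.mem_iUnion.1 hz'
  exact Set.mem_iUnion.2 ⟨i, h i z z' (fun m => hz (i, m)) hi⟩

theorem IsCD.inter {X Y : Set (M.D a)} (hX : M.IsCD X) (hY : M.IsCD Y) : M.IsCD (X ∩ Y) := by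
  have := (IsCD.iUnion (X := fun i : Bool => cond i Yᶜ Xᶜ)
    (Bool.forall_bool.2 ⟨hX.compl, hY.compl⟩)).compl
  convert this using 1
  ext z
  simp

theorem IsCD.preimage {Y : Set (M.D b)} (hY : M.IsCD Y) (f : Std a → Std b) :
    M.IsCD (M.starFun f ⁻¹' Y) := by
  obtain ⟨Z, hZ, h⟩ := hY.exists_forall
  exact isCD_of_forall (fun m => M.starFun f ⁻¹' Z m) (fun m => (hZ m).preimage f)
    fun z z' hz => h _ _ hz

theorem IsBorel.isCD {X : Set (M.D a)} (hX : M.IsBorel X) : M.IsCD X := by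
  refine MeasurableSpace.generateFrom_induction _ (fun s _ => M.IsCD s) (fun s hs _ => ?_) ?_
    (fun s _ h => h.compl) (fun s _ h => IsCD.iUnion h) X hX
  · exact IsInternal.isCD hs
  · exact isInternal_empty.isCD

theorem isCD_stdNat : M.IsCD M.stdNat := by
  have : M.stdNat = ⋃ n : ℕ, {M.star (a := Ty.nat) n} := by
    ext x
    simp [stdNat, eq_comm]
  rw [this]
  exact IsCD.iUnion fun n => (isInternal_singleton _).isCD

theorem IsCD.prodSet {X : Set (M.D a)} {Y : Set (M.D b)} (hX : M.IsCD X) (hY : M.IsCD Y) :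
    M.IsCD (M.prodSet X Y) := by
  have : M.prodSet X Y = M.fst ⁻¹' X ∩ M.snd ⁻¹' Y := by
    ext z
    simp only [NonstandardUniverse.prodSet, Set.mem_ofPred_eq, Set.mem_inter_iff, Set.mem_preimage]
    constructor
    · rintro ⟨x, hx, y, hy, rfl⟩
      simp [hx, hy]
    · rintro ⟨h1, h2⟩
      exact ⟨_, h1, _, h2, (M.pair_fst_snd z).symm⟩
  rw [this]
  exact (hX.preimage (a := Ty.prod a b) Prod.fst).inter (hY.preimage (a := Ty.prod a b) Prod.snd)

theorem cdLe_of_injOn {X : Set (M.D a)} {Y : Set (M.D b)} (F : M.D a → M.D b)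
    (hF : Set.MapsTo F X Y) (hinj : Set.InjOn F X)
    (hcd : M.IsCD {z : M.D (Ty.prod a b) | M.fst z ∈ X ∧ M.snd z = F (M.fst z)}) :
    M.CDLe X Y := by
  refine ⟨fun x => ⟨F x, hF x.2⟩, fun x x' h => Subtype.ext (hinj x.2 x'.2 (by simpa using h)), ?_⟩
  unfold IsCDMap
  convert hcd using 1
  ext z
  simp [eq_pair_iff]

/-- Standard functions induce countably determined maps. -/
theorem cdLe_of_starFun {X : Set (M.D a)} {Y : Set (M.D b)} (hX : M.IsCD X) (f : Std a → Std b)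
    (hf : Set.MapsTo (M.starFun f) X Y) (hinj : Set.InjOn (M.starFun f) X) : M.CDLe X Y := by
  refine cdLe_of_injOn (M.starFun f) hf hinj ?_
  have hI : M.IsInternal {z : M.D (Ty.prod a b) | M.snd z = M.starFun f (M.fst z)} := ?_
  · exact (hX.preimage (a := Ty.prod a b) Prod.fst).inter hI.isCD
  convert M.isInternal_eventually (a := Ty.prod a b) (fun p : Std a × Std b => p.2 = f p.1) using 1
  ext z
  rw [Set.mem_ofPred_eq, Set.mem_ofPred_eq, fst, snd, starFun_starFun, starFun_eq_starFun_iff]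

theorem cdLe_of_subset {X Y : Set (M.D a)} (hX : M.IsCD X) (h : X ⊆ Y) : M.CDLe X Y :=
  cdLe_of_starFun hX (fun t => t) (fun x hx => by rw [starFun_id]; exact h hx)
    (fun x _ y _ hxy => by rwa [starFun_id, starFun_id] at hxy)

end Internal

/-! ### Rational shifts, standard parts and the construction of CD injections. -/

/-- There is an injection of the real line into `(0, 1)` that moves every point by a rational
number. -/
theorem exists_rat_shift : ∃ q : ℝ → ℚ, (∀ r, 0 < r + q r ∧ r + q r < 1) ∧
    Function.Injective fun r => r + (q r : ℝ) := by
  -- Real numbers modulo `ℚ`. In a class with representative `c`, the points `c + p` are moved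
  -- injectively to points `c + e p` of the same class inside `(0, 1)`.
  let s : Setoid ℝ :=
    { r := fun r t => ∃ p : ℚ, t = r + p
      iseqv :=
        ⟨fun r => ⟨0, by simp⟩, fun {r t} ⟨p, hp⟩ => ⟨-p, by rw [hp]; push_cast; ring⟩,
          fun {r t w} ⟨p, hp⟩ ⟨p', hp'⟩ => ⟨p + p', by rw [hp', hp]; push_cast; ring⟩⟩ }
  let rep : ℝ → ℝ := fun r => (Quotient.mk s r).out
  have hrep : ∀ r, ∃ p : ℚ, r = rep r + p := fun r => Quotient.mk_out (s := s) r
  have hrep' : ∀ r (p : ℚ), rep (r + p) = rep r := by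
    intro r p
    have : Quotient.mk s (r + p) = Quotient.mk s r := (Quotient.sound (s := s) ⟨p, rfl⟩).symm
    simp only [rep, this]
  have he : ∀ c : ℝ, ∃ e : ℚ → ℚ, Function.Injective e ∧ ∀ p, 0 < c + e p ∧ c + e p < 1 := by
    intro c
    obtain ⟨p₁, h1, h2⟩ := exists_rat_btwn (show -c < 1 - c by linarith)
    obtain ⟨p₂, h3, h4⟩ := exists_rat_btwn h2
    have hlt : p₁ < p₂ := by exact_mod_cast h3
    have hinf : Infinite (Set.Ioo p₁ p₂) := (Set.Ioo_infinite hlt).to_subtype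
    obtain ⟨i⟩ : Nonempty (ℚ ↪ Set.Ioo p₁ p₂) :=
      ⟨(Encodable.encode' ℚ).trans (Infinite.natEmbedding _)⟩
    refine ⟨fun p => (i p : ℚ), fun p p' h => i.injective (Subtype.ext h), fun p => ?_⟩
    have h5 : (p₁ : ℝ) < ((i p : ℚ) : ℝ) := by exact_mod_cast (i p).2.1
    have h6 : ((i p : ℚ) : ℝ) < (p₂ : ℝ) := by exact_mod_cast (i p).2.2
    constructor <;> linarith
  choose p hp using hrep
  choose e hinj he using he
  have hsum : ∀ r, r + ((e (rep r) (p r) - p r : ℚ) : ℝ) = rep r + e (rep r) (p r) := by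
    intro r
    conv_lhs => rw [hp r]
    have h1 : rep (rep r + p r) = rep r := by rw [← hp r]
    have h2 : p (rep r + p r) = p r := by rw [← hp r]
    rw [h1, h2]
    push_cast
    ring
  refine ⟨fun r => e (rep r) (p r) - p r, fun r => ?_, fun r t hrt => ?_⟩
  · rw [hsum]
    exact he _ _
  -- Shifting keeps the class, so equal values have equal representatives, and `e` is injective for
  -- a fixed representative.
  · have h0 := hrt
    simp only at h0
    rw [hsum, hsum] at h0
    have h1 := congrArg rep hrt
    simp only at h1
    rw [hrep', hrep'] at h1
    rw [h1] at h0
    have h2 : p r = p t := hinj (rep t) (by exact_mod_cast add_left_cancel h0)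
    rw [hp r, hp t, h1, h2]

theorem tendsto_int_floor_mul_div (q : ℝ) :
    Tendsto (fun m : ℕ => (⌊q * m⌋ : ℝ) / m) atTop (𝓝 q) := by
  have h1 : Tendsto (fun m : ℕ => q - (1 : ℝ) / m) atTop (𝓝 q) := by
    simpa using tendsto_const_nhds.sub (tendsto_one_div_atTop_nhds_zero_nat (𝕜 := ℝ))
  refine tendsto_of_tendsto_of_tendsto_of_le_of_le' h1 tendsto_const_nhds ?_ ?_
  all_goals
    filter_upwards [eventually_gt_atTop 0] with m hm
    have hm' : (0 : ℝ) < m := by exact_mod_cast hm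
  · rw [le_div_iff₀ hm', sub_mul, one_div, inv_mul_cancel₀ hm'.ne']
    exact (Int.sub_one_lt_floor _).le
  · rw [div_le_iff₀ hm']
    exact Int.floor_le _

/-- `k` shifted by the fraction `q` of `m`. -/
noncomputable def shift (q : ℚ) (k m : ℕ) : ℕ := ((k : ℤ) + ⌊(q : ℝ) * m⌋).toNat

/-- `q` may be negative, but the limit `r + q` of the shifted quotient is positive. So the shifted
integer is eventually nonnegative and `toNat` truncates nothing. -/
theorem eventually_shift {ι : Type*} {l : Filter ι} {k m : ι → ℕ} {r : ℝ} {q : ℚ}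
    (hm : Tendsto m l atTop) (hk : Tendsto (fun i => (k i : ℝ) / m i) l (𝓝 r)) (hr : 0 < r + q) :
    ∀ᶠ i in l, (shift q (k i) (m i) : ℤ) = k i + ⌊(q : ℝ) * m i⌋ := by
  have h := hk.add ((tendsto_int_floor_mul_div q).comp hm)
  filter_upwards [h.eventually (lt_mem_nhds hr), hm.eventually_gt_atTop 0] with i hi hmi
  have hmi' : (0 : ℝ) < m i := by exact_mod_cast hmi
  rw [Function.comp_apply, ← add_div, lt_div_iff₀ hmi', zero_mul] at hi
  exact Int.toNat_of_nonneg (by exact_mod_cast hi.le)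

theorem tendsto_shift_div {ι : Type*} {l : Filter ι} {k m : ι → ℕ} {r : ℝ} {q : ℚ}
    (hm : Tendsto m l atTop) (hk : Tendsto (fun i => (k i : ℝ) / m i) l (𝓝 r)) (hr : 0 < r + q) :
    Tendsto (fun i => (shift q (k i) (m i) : ℝ) / m i) l (𝓝 (r + q)) := by
  refine (hk.add ((tendsto_int_floor_mul_div q).comp hm)).congr' ?_
  filter_upwards [eventually_shift hm hk hr] with i hi
  have : (shift q (k i) (m i) : ℝ) = k i + ⌊(q : ℝ) * m i⌋ := by exact_mod_cast hi
  rw [this, Function.comp_apply, add_div]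

variable {M : NonstandardUniverse.{u}} {a b c : Ty}

/-- An ultrafilter on `ℕ` is nonprincipal or a point mass, and a point mass at `n` would force `x`
to be the standard number `n`. -/
theorem ultra_le_atTop {x : M.HNat} (hx : x ∉ M.stdNat) : (M.ultra x : Filter ℕ) ≤ atTop := by
  rw [← Nat.cofinite_eq_atTop]
  rcases (M.ultra x).le_cofinite_or_eq_pure with h | ⟨n, hn⟩
  · exact h
  · refine absurd ⟨n, ?_⟩ hx
    change M.star (a := Ty.nat) n = x
    conv_rhs => rw [← M.starFun_id x]
    rw [← M.starFun_const (b := Ty.nat) n x, starFun_eq_starFun_iff, hn]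
    simp

theorem tendsto_atTop_of_notMem_stdNat {m : Std a → ℕ} {t : M.D a}
    (hx : M.starFun (b := Ty.nat) m t ∉ M.stdNat) : Tendsto m (M.ultra t) atTop := by
  have := ultra_le_atTop hx
  rwa [ultra_starFun] at this

theorem ultra_ratio_le_nhds {f m : Std a → ℕ} {t : M.D a} {r : ℝ} :
    ((M.ultra (M.ratio (M.starFun (b := Ty.nat) f t) (M.starFun (b := Ty.nat) m t)) : Filter ℝ) ≤
      𝓝 r) ↔ Tendsto (fun s => (f s : ℝ) / m s) (M.ultra t) (𝓝 r) := by
  rw [ratio_starFun, ultra_starFun]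
  rfl

variable (M) in
/-- The shift of `y` by the fraction `q` of `x`. -/
noncomputable def hshift (q : ℚ) (y x : M.HNat) : M.HNat :=
  M.starFun (a := Ty.prod Ty.nat Ty.nat) (b := Ty.nat) (fun p : ℕ × ℕ => shift q p.1 p.2)
    (M.pair y x)

theorem hshift_starFun (q : ℚ) (f m : Std a → ℕ) (t : M.D a) :
    M.hshift q (M.starFun (b := Ty.nat) f t) (M.starFun (b := Ty.nat) m t) =
      M.starFun (b := Ty.nat) (fun s => shift q (f s) (m s)) t := by
  unfold hshift
  rw [pair_starFun]
  exact M.starFun_starFun (b := Ty.prod Ty.nat Ty.nat) (c := Ty.nat) _ _ _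

theorem ultra_ratio_hshift {x y : M.HNat} (hx : x ∉ M.stdNat) {r : ℝ} {q : ℚ}
    (h : (M.ultra (M.ratio y x) : Filter ℝ) ≤ 𝓝 r) (hr : 0 < r + q) :
    (M.ultra (M.ratio (M.hshift q y x) x) : Filter ℝ) ≤ 𝓝 (r + q) := by
  obtain ⟨e, t, f, m, rfl, rfl⟩ := M.exists_starFun₂ y x
  rw [hshift_starFun]
  rw [ultra_ratio_le_nhds] at h ⊢
  exact tendsto_shift_div (tendsto_atTop_of_notMem_stdNat hx) h hr

theorem hshift_injective {x y z : M.HNat} (hx : x ∉ M.stdNat) {r : ℝ} {q : ℚ}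
    (hy : (M.ultra (M.ratio y x) : Filter ℝ) ≤ 𝓝 r)
    (hz : (M.ultra (M.ratio z x) : Filter ℝ) ≤ 𝓝 r) (hr : 0 < r + q)
    (h : M.hshift q y x = M.hshift q z x) : y = z := by
  obtain ⟨e, t, f, g, m, rfl, rfl, rfl⟩ := M.exists_starFun₃ y z x
  rw [hshift_starFun, hshift_starFun, starFun_eq_starFun_iff] at h
  rw [ultra_ratio_le_nhds] at hy hz
  have hm := tendsto_atTop_of_notMem_stdNat hx
  rw [starFun_eq_starFun_iff]
  filter_upwards [h, eventually_shift hm hy hr, eventually_shift hm hz hr] with i h1 h2 h3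
  rw [h1, h3] at h2
  exact (Int.natCast_inj.1 (add_right_cancel h2)).symm

theorem lt_of_ultra_ratio {x y : M.HNat} (hx : x ∉ M.stdNat) {r : ℝ}
    (h : (M.ultra (M.ratio y x) : Filter ℝ) ≤ 𝓝 r) (hr : r < 1) : M.lt y x := by
  obtain ⟨e, t, f, m, rfl, rfl⟩ := M.exists_starFun₂ y x
  rw [ultra_ratio_le_nhds] at h
  rw [lt_starFun]
  filter_upwards [h.eventually (gt_mem_nhds hr),
    (tendsto_atTop_of_notMem_stdNat hx).eventually_gt_atTop 0] with i hi hm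
  have hm' : (0 : ℝ) < m i := by exact_mod_cast hm
  rw [div_lt_one hm'] at hi
  exact_mod_cast hi

theorem ultra_nhds_unique {α : M.HReal} {r s : ℝ} (hr : (M.ultra α : Filter ℝ) ≤ 𝓝 r)
    (hs : (M.ultra α : Filter ℝ) ≤ 𝓝 s) : r = s :=
  eq_of_nhds_neBot (neBot_of_le (f := (M.ultra α : Filter ℝ)) (le_inf hr hs))

/-- Convergence of `ultra α` to `r` expresses that `r` is the standard part of `α`. For bounded `α`
the limit exists by compactness of `[l, u]`. -/
theorem exists_ultra_le_nhds {α : M.HReal} {l u : ℝ}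
    (h : ∀ᶠ s in (M.ultra α : Filter ℝ), s ∈ Set.Icc l u) :
    ∃ r, (M.ultra α : Filter ℝ) ≤ 𝓝 r := by
  obtain ⟨r, -, hr⟩ := isCompact_Icc.ultrafilter_le_nhds (M.ultra α) (le_principal_iff.2 h)
  exact ⟨r, hr⟩

/-- A countably determined set that is mapped injectively into `xℕ`, where `x` is infinite, has a
countably determined injection into `[0, x)`. -/
theorem cdLe_below {X : Set (M.D a)} (hX : M.IsCD X) (g : Std a → ℕ)
    (hinj : Set.InjOn (M.starFun (b := Ty.nat) g) X) {x : M.HNat} (hx : x ∉ M.stdNat)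
    (hb : ∀ z ∈ X, ∃ n : ℕ,
      M.le (M.starFun (b := Ty.nat) g z) (M.mul x (M.star (a := Ty.nat) n))) :
    M.CDLe X (M.below x) := by
  have hρ : ∀ z ∈ X, ∃ r : ℝ,
      (M.ultra (M.ratio (M.starFun (b := Ty.nat) g z) x) : Filter ℝ) ≤ 𝓝 r := by
    intro z hz
    obtain ⟨n, hn⟩ := hb z hz
    apply exists_ultra_le_nhds (l := 0) (u := n)
    obtain ⟨e, t, f, m, rfl, rfl⟩ := M.exists_starFun₂ z x
    rw [← M.starFun_const (b := Ty.nat) n t, starFun_starFun, mul_starFun, le_starFun] at hn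
    rw [starFun_starFun, ratio_starFun, ultra_starFun, eventually_map]
    filter_upwards [hn, (tendsto_atTop_of_notMem_stdNat hx).eventually_gt_atTop 0] with i hi hm
    have hm' : (0 : ℝ) < m i := by exact_mod_cast hm
    refine ⟨by positivity, ?_⟩
    rw [div_le_iff₀ hm', mul_comm]
    exact_mod_cast hi
  choose! ρ hρ using hρ
  obtain ⟨q, hq, hqinj⟩ := exists_rat_shift
  have hlim : ∀ z ∈ X, (M.ultra (M.ratio
      (M.hshift (q (ρ z)) (M.starFun (b := Ty.nat) g z) x) x) : Filter ℝ) ≤ 𝓝 (ρ z + q (ρ z)) :=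
    fun z hz => ultra_ratio_hshift hx (hρ z hz) (hq _).1
  -- The standard part is determined by the rational cut of the ratio.
  have hcd : ∀ z z', z ∈ X → z' ∈ X → (∀ p : ℚ,
      (∀ᶠ s : ℝ in (M.ultra (M.ratio (M.starFun (b := Ty.nat) g z) x) : Filter ℝ), s < (p : ℝ)) ↔
      ∀ᶠ s : ℝ in (M.ultra (M.ratio (M.starFun (b := Ty.nat) g z') x) : Filter ℝ), s < (p : ℝ)) →
      ρ z ≤ ρ z' := by
    intro z z' hz hz' h
    by_contra! hlt
    obtain ⟨p, h1, h2⟩ := exists_rat_btwn hlt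
    have h3 := (h p).2 (hρ z' hz' (gt_mem_nhds h1))
    obtain ⟨s, h4, h5⟩ := (h3.and (hρ z hz (lt_mem_nhds h2))).exists
    exact lt_asymm h4 h5
  refine cdLe_of_injOn (fun z => M.hshift (q (ρ z)) (M.starFun (b := Ty.nat) g z) x)
    (fun z hz => lt_of_ultra_ratio hx (hlim z hz) (hq _).2) (fun z hz z' hz' h => ?_) ?_
  · have h1 : ρ z = ρ z' := by
      apply hqinj
      have := hlim z' hz'
      simp only at h
      rw [← h] at this
      exact ultra_nhds_unique (hlim z hz) this
    simp only [h1] at h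
    exact hinj hz hz' (hshift_injective hx (h1 ▸ hρ z hz) (hρ z' hz') (hq _).1 h)
  · obtain ⟨Y, hY, hYX⟩ := hX.exists_forall
    -- Three countable families of internal sets decide membership in the graph: those deciding `X`,
    -- the rational cuts that fix `ρ`, and the graphs of the shifts by each rational `p`.
    refine isCD_of_forall (ι := ℕ ⊕ ℚ ⊕ ℚ) (Sum.elim (fun n => M.fst ⁻¹' Y n) (Sum.elim
      (fun p => {z | M.starRel (a := Ty.prod a Ty.nat) (b := Ty.nat)
        (fun (s : Std a × ℕ) (m : ℕ) => (g s.1 : ℝ) / m < p) z x})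
      (fun p => {z | M.starRel (a := Ty.prod a Ty.nat) (b := Ty.nat)
        (fun (s : Std a × ℕ) (m : ℕ) => s.2 = shift p (g s.1) m) z x}))) ?_ ?_
    · rintro (n | p | p)
      · exact (hY n).preimage (a := Ty.prod a Ty.nat) Prod.fst
      · exact M.isInternal_starRel (a := Ty.prod a Ty.nat) (b := Ty.nat)
          (fun (s : Std a × ℕ) (m : ℕ) => (g s.1 : ℝ) / m < p) x
      · exact M.isInternal_starRel (a := Ty.prod a Ty.nat) (b := Ty.nat)
          (fun (s : Std a × ℕ) (m : ℕ) => s.2 = shift p (g s.1) m) x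
    · rintro z z' h ⟨hz1, hz2⟩
      have h1 := fun n => h (Sum.inl n)
      have h2 := fun p => h (Sum.inr (Sum.inl p))
      have h3 := fun p => h (Sum.inr (Sum.inr p))
      simp only [Sum.elim_inl, Sum.elim_inr, Set.mem_ofPred_eq, Set.mem_preimage] at h1 h2 h3
      have hz'1 : M.fst z' ∈ X := hYX _ _ h1 hz1
      have e2 : ∀ (z : M.D (Ty.prod a Ty.nat)) (p : ℚ), M.starRel (a := Ty.prod a Ty.nat)
          (b := Ty.nat) (fun (s : Std a × ℕ) (m : ℕ) => (g s.1 : ℝ) / m < p) z x ↔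
          ∀ᶠ s : ℝ in (M.ultra (M.ratio (M.starFun (b := Ty.nat) g (M.fst z)) x) : Filter ℝ),
            s < (p : ℝ) := by
        intro z p
        obtain ⟨e, t, f, m, rfl, rfl⟩ := M.exists_starFun₂ z x
        unfold fst
        rw [starRel_starFun, starFun_starFun, starFun_starFun, ratio_starFun, ultra_starFun]
        rfl
      have e3 : ∀ (z : M.D (Ty.prod a Ty.nat)) (p : ℚ), M.starRel (a := Ty.prod a Ty.nat)
          (b := Ty.nat) (fun (s : Std a × ℕ) (m : ℕ) => s.2 = shift p (g s.1) m) z x ↔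
          M.snd z = M.hshift p (M.starFun (b := Ty.nat) g (M.fst z)) x := by
        intro z p
        obtain ⟨e, t, f, m, rfl, rfl⟩ := M.exists_starFun₂ z x
        unfold fst snd
        rw [starRel_starFun, starFun_starFun, starFun_starFun, starFun_starFun,
          hshift_starFun, starFun_eq_starFun_iff]
      simp only [e2] at h2
      simp only [e3] at h3
      have hρz : ρ (M.fst z) = ρ (M.fst z') :=
        le_antisymm (hcd _ _ hz1 hz'1 h2) (hcd _ _ hz'1 hz1 fun p => (h2 p).symm)
      refine ⟨hz'1, ?_⟩
      rw [← hρz]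
      exact (h3 _).1 hz2

/-! ### Order, internal counting, and values missed by CD functional relations. -/

theorem lt_iff_not_le (x y : M.HNat) : M.lt x y ↔ ¬ M.le y x := by
  obtain ⟨e, t, f, g, rfl, rfl⟩ := M.exists_starFun₂ x y
  rw [lt_starFun, le_starFun, ← Ultrafilter.eventually_not]
  simp

theorem le_of_lt {x y : M.HNat} (h : M.lt x y) : M.le x y := by
  obtain ⟨e, t, f, g, rfl, rfl⟩ := M.exists_starFun₂ x y
  rw [lt_starFun] at h
  rw [le_starFun]
  exact h.mono fun _ => Nat.le_of_lt

theorem le_total (x y : M.HNat) : M.le x y ∨ M.le y x := by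
  by_cases h : M.le y x
  · exact Or.inr h
  · exact Or.inl (le_of_lt ((lt_iff_not_le x y).2 h))

theorem le_trans {x y z : M.HNat} (h : M.le x y) (h' : M.le y z) : M.le x z := by
  obtain ⟨e, t, f, g, k, rfl, rfl, rfl⟩ := M.exists_starFun₃ x y z
  rw [le_starFun] at h h' ⊢
  exact (h.and h').mono fun _ h => h.1.trans h.2

/-- Choosing a preimage of each value is injective because `A` is functional. The exponent `n + 2`
makes the sum of the fractions over all `n` equal to `1 / 2`, leaving room for the error terms `+
1`. -/
theorem card_image_le (A : Set (ℕ × ℕ)) (hA : ∀ u w w', (u, w) ∈ A → (u, w') ∈ A → w = w')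
    (n v : ℕ) :
    {w | ∃ u, u * 2 ^ (n + 2) < v ∧ (u, w) ∈ A}.Finite ∧
      ({w | ∃ u, u * 2 ^ (n + 2) < v ∧ (u, w) ∈ A}.ncard : ℝ) ≤ v / 2 ^ (n + 2) + 1 := by
  set S := {w | ∃ u, u * 2 ^ (n + 2) < v ∧ (u, w) ∈ A} with hS
  have hw : ∀ w ∈ S, ∃ u, u * 2 ^ (n + 2) < v ∧ (u, w) ∈ A := fun w hw => hw
  choose! u hu huA using hw
  have hmaps : ∀ w ∈ S, u w ∈ (Finset.range (v / 2 ^ (n + 2) + 1) : Set ℕ) := by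
    intro w hw
    rw [Finset.mem_coe, Finset.mem_range, Nat.lt_succ_iff, Nat.le_div_iff_mul_le (by positivity)]
    exact (hu w hw).le
  have hinj : Set.InjOn u S := fun w hw w' hw' h =>
    hA (u w) w w' (huA w hw) (h ▸ huA w' hw')
  have hfin : S.Finite := Set.Finite.of_injOn hmaps hinj (Finset.finite_toSet _)
  refine ⟨hfin, ?_⟩
  have h1 := Set.ncard_le_ncard_of_injOn u hmaps hinj (Finset.finite_toSet _)
  rw [Set.ncard_coe_finset, Finset.card_range] at h1
  calc (S.ncard : ℝ) ≤ ((v / 2 ^ (n + 2) + 1 : ℕ) : ℝ) := by exact_mod_cast h1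
    _ = ((v / 2 ^ (n + 2) : ℕ) : ℝ) + 1 := by push_cast; rfl
    _ ≤ (v : ℝ) / ((2 ^ (n + 2) : ℕ) : ℝ) + 1 := by gcongr; exact Nat.cast_div_le
    _ = v / 2 ^ (n + 2) + 1 := by push_cast; rfl

/-- The image of `{u | u * 2 ^ (n + 2) < v}` under an internal relation. -/
def smallImage (A : Set (M.D (Ty.prod Ty.nat Ty.nat))) (v : M.HNat) (n : ℕ) : Set M.HNat :=
  {w | ∃ u, M.lt (M.mul u (M.star (a := Ty.nat) (2 ^ (n + 2)))) v ∧ M.pair u w ∈ A}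

variable (M) in
/-- The union of the first `N` of the sets `smallImage` has few elements, internally. -/
def FewElements (B : M.D (Ty.pow Ty.nat)) (v : M.HNat) (N : ℕ) : Prop :=
  M.starRel (a := Ty.pow Ty.nat) (b := Ty.nat) (fun (S : Set ℕ) (v : ℕ) => S.Finite ∧
    (S.ncard : ℝ) ≤ v / 2 * (1 - (1 / 2) ^ N) + N) B v

/-- The internal quantifier over `u` becomes a pointwise one, since standard witnesses can be chosen
for each `s` separately. This makes `smallImage` internal. -/
theorem mem_smallImage_iff (A : M.D (Ty.pow (Ty.prod Ty.nat Ty.nat))) (v : M.HNat) (n : ℕ)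
    (w : M.HNat) :
    w ∈ smallImage (M.ext A) v n ↔ M.starRel (a := Ty.nat)
      (b := Ty.prod (Ty.pow (Ty.prod Ty.nat Ty.nat)) Ty.nat)
      (fun (w : ℕ) (p : Set (ℕ × ℕ) × ℕ) => ∃ u, u * 2 ^ (n + 2) < p.2 ∧ (u, w) ∈ p.1)
      w (M.pair A v) := by
  obtain ⟨e, t, f, S, g, rfl, rfl, rfl⟩ := M.exists_starFun₃ w A v
  rw [pair_starFun, starRel_starFun]
  constructor
  · rintro ⟨u, hu, huA⟩
    obtain ⟨e', t', f', h, rfl, rfl⟩ := M.exists_starFun₂ t u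
    rw [ultra_starFun, eventually_map]
    simp only [starFun_starFun] at hu huA
    rw [pair_starFun, mem_ext] at huA
    rw [← M.starFun_const (b := Ty.nat) _ t', mul_starFun, lt_starFun] at hu
    have huA' := (M.mem_starFun_iff (b := Ty.prod Ty.nat Ty.nat) _ _ t').1 huA
    filter_upwards [hu, huA'] with s h1 h2
    exact ⟨h s, h1, h2⟩
  · intro h
    -- A witness is needed at every `s` to obtain a total function; `0` is a default where none
    -- exists.
    have h' : ∀ s, ∃ u : ℕ, (∃ u, u * 2 ^ (n + 2) < g s ∧ (u, f s) ∈ S s) →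
        u * 2 ^ (n + 2) < g s ∧ (u, f s) ∈ S s := by
      intro s
      by_cases hs : ∃ u : ℕ, u * 2 ^ (n + 2) < g s ∧ (u, f s) ∈ S s
      · exact hs.imp fun u hu _ => hu
      · exact ⟨0, fun h => absurd h hs⟩
    choose u hu using h'
    refine ⟨M.starFun (b := Ty.nat) u t, ?_, ?_⟩
    · rw [← M.starFun_const (b := Ty.nat) _ t, mul_starFun, lt_starFun]
      exact h.mono fun s hs => (hu s hs).1
    · rw [pair_starFun, mem_ext]
      exact (M.mem_starFun_iff (b := Ty.prod Ty.nat Ty.nat) _ S t).2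
        (h.mono fun s hs => (hu s hs).2)

/-- A set of pairs is functional if the second component is determined by the first one. -/
def IsFunctional (G : Set (M.D (Ty.prod a b))) : Prop :=
  ∀ u w w', M.pair u w ∈ G → M.pair u w' ∈ G → w = w'

/-- Otherwise violating triples, chosen pointwise, would assemble into an internal violation. -/
theorem IsFunctional.eventually {S : Std c → Set (Std a × Std b)} {t : M.D c}
    (h : IsFunctional (M.ext (a := Ty.prod a b) (M.starFun (b := Ty.pow (Ty.prod a b)) S t))) :
    ∀ᶠ s in M.ultra t, ∀ u w w', (u, w) ∈ S s → (u, w') ∈ S s → w = w' := by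
  by_contra hcon
  rw [← Ultrafilter.eventually_not] at hcon
  have hne := fun d => nonempty_std d
  have h' : ∀ s, ∃ p : Std a × Std b × Std b,
      (¬ ∀ u w w', (u, w) ∈ S s → (u, w') ∈ S s → w = w') →
      (p.1, p.2.1) ∈ S s ∧ (p.1, p.2.2) ∈ S s ∧ p.2.1 ≠ p.2.2 := by
    intro s
    by_cases hs : ∀ u w w', (u, w) ∈ S s → (u, w') ∈ S s → w = w'
    · exact ⟨((hne a).some, (hne b).some, (hne b).some), fun h => absurd hs h⟩
    · push Not at hs
      obtain ⟨u, w, w', h1, h2, h3⟩ := hs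
      exact ⟨(u, w, w'), fun _ => ⟨h1, h2, h3⟩⟩
  choose p hp using h'
  have h3 := h (M.starFun (fun s => (p s).1) t) (M.starFun (fun s => (p s).2.1) t)
    (M.starFun (fun s => (p s).2.2) t)
    (by
      rw [pair_starFun, mem_ext]
      exact (M.mem_starFun_iff (b := Ty.prod a b) _ S t).2 (hcon.mono fun s hs => (hp s hs).1))
    (by
      rw [pair_starFun, mem_ext]
      exact (M.mem_starFun_iff (b := Ty.prod a b) _ S t).2 (hcon.mono fun s hs => (hp s hs).2.1))
  rw [starFun_eq_starFun_iff] at h3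
  obtain ⟨s, h4, h5⟩ := (h3.and hcon).exists
  exact (hp s h5).2.2 h4

/-- The bound in `FewElements` is the partial sum of `v / 2 ^ (n + 2) + 1` over `n < N`. -/
theorem exists_fewElements (A : ℕ → M.D (Ty.pow (Ty.prod Ty.nat Ty.nat)))
    (hA : ∀ n, IsFunctional (M.ext (A n))) (v : M.HNat) (N : ℕ) :
    ∃ B : M.D (Ty.pow Ty.nat), M.FewElements B v N ∧
      ∀ n < N, smallImage (M.ext (A n)) v n ⊆ M.ext B := by
  induction N with
  | zero =>
    refine ⟨M.star (a := Ty.pow Ty.nat) (∅ : Set ℕ), ?_, fun n hn => absurd hn (Nat.not_lt_zero n)⟩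
    unfold FewElements
    rw [← M.starFun_const (b := Ty.pow Ty.nat) (∅ : Set ℕ) v]
    conv =>
      arg 4
      rw [← M.starFun_id v]
    rw [starRel_starFun]
    exact Eventually.of_forall fun s => by simp
  | succ N ih =>
    obtain ⟨B, hB, hsub⟩ := ih
    obtain ⟨e, t, b, S, g, rfl, hS, rfl⟩ := M.exists_starFun₃ B (A N) v
    have hAN := hA N
    have hmem := mem_smallImage_iff (A N) (M.starFun (b := Ty.nat) g t) N
    rw [hS] at hAN hmem
    unfold FewElements at hB ⊢
    rw [starRel_starFun] at hB
    let H : Std e → Set ℕ := fun s => {w | ∃ u, u * 2 ^ (N + 2) < g s ∧ (u, w) ∈ S s}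
    refine ⟨M.starFun (b := Ty.pow Ty.nat) (fun s => b s ∪ H s) t, ?_, ?_⟩
    · rw [starRel_starFun]
      filter_upwards [hB, hAN.eventually] with s h1 h2
      obtain ⟨h3, h4⟩ := card_image_le (S s) h2 N (g s)
      refine ⟨h1.1.union h3, ?_⟩
      have h5 : ((b s ∪ H s).ncard : ℝ) ≤ (b s).ncard + (H s).ncard := by
        exact_mod_cast Set.ncard_union_le _ _
      calc ((b s ∪ H s).ncard : ℝ) ≤ (b s).ncard + (H s).ncard := h5
        _ ≤ (g s / 2 * (1 - (1 / 2) ^ N) + N) + (g s / 2 ^ (N + 2) + 1) := add_le_add h1.2 h4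
        _ = g s / 2 * (1 - (1 / 2) ^ (N + 1)) + (N + 1 : ℕ) := by
          rw [one_div_pow, one_div_pow, pow_add, pow_succ]
          push_cast
          field_simp
          ring
    · intro n hn w hw
      have key : w ∈ M.ext (M.starFun (b := Ty.pow Ty.nat) b t) ∨
          w ∈ smallImage (M.ext (M.starFun (b := Ty.pow (Ty.prod Ty.nat Ty.nat)) S t))
            (M.starFun (b := Ty.nat) g t) N := by
        rcases Nat.lt_succ_iff_lt_or_eq.1 hn with hn | rfl
        · exact Or.inl (hsub n hn hw)
        · exact Or.inr (hS ▸ hw)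
      rw [hmem] at key
      obtain ⟨e', t', f, r, rfl, rfl⟩ := M.exists_starFun₂ w t
      simp only [starFun_starFun, mem_ext, pair_starFun, starRel_starFun] at key ⊢
      rw [show M.mem _ _ ↔ _ from M.mem_starFun_iff (b := Ty.nat) f _ t'] at key ⊢
      rw [← Ultrafilter.eventually_or] at key
      exact key

/-- The bound is at most `v / 2 + N`, which is less than `v` once `v > 2 * N`, so the pigeonhole
principle applies. -/
theorem exists_notMem_of_fewElements {B : M.D (Ty.pow Ty.nat)} {v : M.HNat} {N : ℕ}
    (hv : v ∉ M.stdNat) (h : M.FewElements B v N) : ∃ w, M.lt w v ∧ w ∉ M.ext B := by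
  obtain ⟨e, t, b, g, rfl, rfl⟩ := M.exists_starFun₂ B v
  unfold FewElements at h
  rw [starRel_starFun] at h
  have h' : ∀ᶠ s in M.ultra t, ∃ w < g s, w ∉ b s := by
    filter_upwards [h, (tendsto_atTop_of_notMem_stdNat hv).eventually_gt_atTop (2 * N)]
      with s ⟨h1, h2⟩ h3
    by_contra! hcon
    have h4 : (Finset.range (g s) : Set ℕ) ⊆ b s := fun w hw =>
      hcon w (Finset.mem_range.1 (Finset.mem_coe.1 hw))
    have h5 := Set.ncard_le_ncard h4 h1
    rw [Set.ncard_coe_finset, Finset.card_range] at h5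
    have h6 : (g s : ℝ) ≤ (b s).ncard := by exact_mod_cast h5
    have h7 : (2 * N : ℝ) < g s := by exact_mod_cast h3
    have h8 : (g s : ℝ) / 2 * (1 - (1 / 2) ^ N) ≤ g s / 2 := by
      apply mul_le_of_le_one_right (by positivity)
      have : (0 : ℝ) < (1 / 2) ^ N := by positivity
      linarith
    linarith
  have h2 : ∀ s, ∃ w, (∃ w < g s, w ∉ b s) → w < g s ∧ w ∉ b s := by
    intro s
    by_cases hs : ∃ w < g s, w ∉ b s
    · exact hs.imp fun w hw _ => hw
    · exact ⟨0, fun h => absurd h hs⟩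
  choose w hw using h2
  refine ⟨M.starFun (b := Ty.nat) w t, ?_, fun hmem => ?_⟩
  · rw [lt_starFun]
    exact h'.mono fun s hs => (hw s hs).1
  · rw [mem_ext, show M.mem _ _ ↔ _ from M.mem_starFun_iff (b := Ty.nat) w b t] at hmem
    obtain ⟨s, h3, h4⟩ := (hmem.and h').exists
    exact (hw s h4).2 h3

theorem isInternal_smallImage (A : M.D (Ty.pow (Ty.prod Ty.nat Ty.nat))) (v : M.HNat) (n : ℕ) :
    M.IsInternal (smallImage (M.ext A) v n) := by
  simp only [Set.ext fun w => mem_smallImage_iff A v n w]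
  exact M.isInternal_starRel (a := Ty.nat) (b := Ty.prod (Ty.pow (Ty.prod Ty.nat Ty.nat)) Ty.nat)
    (fun (w : ℕ) (p : Set (ℕ × ℕ) × ℕ) => ∃ u, u * 2 ^ (n + 2) < p.2 ∧ (u, w) ∈ p.1)
    (M.pair A v)

theorem isInternal_below (v : M.HNat) : M.IsInternal (M.below v) :=
  M.isInternal_starRel (a := Ty.nat) (b := Ty.nat) (fun m n : ℕ => m < n) v

/-- Any finite number of the images leaves some `w` below `v` uncovered; saturation gives one `w`
avoiding all of them. -/
theorem exists_notMem_smallImage (A : ℕ → M.D (Ty.pow (Ty.prod Ty.nat Ty.nat)))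
    (hA : ∀ n, IsFunctional (M.ext (A n))) {v : M.HNat} (hv : v ∉ M.stdNat) :
    ∃ w, M.lt w v ∧ ∀ n, w ∉ smallImage (M.ext (A n)) v n := by
  obtain ⟨w, hw⟩ := exists_mem_iInter
    (Y := fun n => M.below v ∩ (smallImage (M.ext (A n)) v n)ᶜ)
    (fun n => (isInternal_below v).inter (isInternal_smallImage _ _ _).compl) fun N => by
      obtain ⟨B, hB, hsub⟩ := exists_fewElements A hA v N
      obtain ⟨w, hw, hwB⟩ := exists_notMem_of_fewElements hv hB
      exact ⟨w, Set.mem_iInter₂.2 fun n hn => ⟨hw, fun h => hwB (hsub n hn h)⟩⟩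
  rw [Set.mem_iInter] at hw
  exact ⟨w, (hw 0).1, fun n => (hw n).2⟩

/-- A countably determined functional relation is covered by countably many internal ones. -/
theorem IsCD.exists_functional_cover {F : Set (M.D (Ty.prod a b))} (hF : M.IsCD F)
    (hfun : IsFunctional F) :
    ∃ A : ℕ → M.D (Ty.pow (Ty.prod a b)), (∀ n, IsFunctional (M.ext (A n))) ∧
      F ⊆ ⋃ n, M.ext (A n) := by
  classical
  obtain ⟨Y, hY, hYF⟩ := hF.exists_forall
  let T : (ℕ → Prop) → ℕ → Set (M.D (Ty.prod a b)) := fun s i => if s i then Y i else (Y i)ᶜ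
  have hT : ∀ s i, M.IsInternal (T s i) := by
    intro s i
    simp only [T]
    split_ifs
    exacts [hY i, (hY i).compl]
  have hmT : ∀ s i z, z ∈ T s i ↔ (z ∈ Y i ↔ s i) := by
    intro s i z
    simp only [T]
    split_ifs with h <;> simp [h]
  -- The atoms of the first `p.1` internal sets. There are countably many in all, and the functional
  -- ones will form the cover.
  let G : ℕ × Finset ℕ → Set (M.D (Ty.prod a b)) := fun p => ⋂ i < p.1, T (fun i => i ∈ p.2) i
  have hG : ∀ p, M.IsInternal (G p) := fun p => isInternal_biInter_lt (hT _) _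
  obtain ⟨e, he⟩ := exists_surjective_nat (ℕ × Finset ℕ)
  have hA : ∀ n, M.IsInternal (if IsFunctional (G (e n)) then G (e n) else ∅) := by
    intro n
    split_ifs
    exacts [hG _, isInternal_empty]
  choose A hA using hA
  refine ⟨A, fun n => ?_, fun z hz => ?_⟩
  · rw [← hA]
    split_ifs with h
    · exact h
    · exact fun u w w' h => absurd h (Set.notMem_empty _)
  · suffices h : ∃ k, IsFunctional (⋂ i < k, T (fun i => z ∈ Y i) i) by
      obtain ⟨k, hk⟩ := h
      obtain ⟨n, hn⟩ := he (k, (Finset.range k).filter fun i => z ∈ Y i)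
      have hGn : G (e n) = ⋂ i < k, T (fun i => z ∈ Y i) i := by
        rw [hn]
        ext z'
        simp only [G, Set.mem_iInter, hmT, Finset.mem_filter, Finset.mem_range]
        exact forall₂_congr fun i hi => by simp [hi]
      refine Set.mem_iUnion.2 ⟨n, ?_⟩
      rw [← hA, hGn, if_pos hk, Set.mem_iInter₂]
      exact fun i _ => (hmT (fun i => z ∈ Y i) i z).2 Iff.rfl
    -- If no finite atom around `z` were functional, saturation would give `w ≠ w'` with `(u, w)`
    -- and `(u, w')` both in the full atom of `z`. Both pairs would then lie in `F`.
    by_contra! hcon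
    let f₁ : Std a × Std b × Std b → Std a × Std b := fun p => (p.1, p.2.1)
    let f₂ : Std a × Std b × Std b → Std a × Std b := fun p => (p.1, p.2.2)
    have hf₁ : ∀ u w w', M.starFun (a := Ty.prod a (Ty.prod b b)) (b := Ty.prod a b) f₁
        (M.pair u (M.pair w w')) = M.pair u w := by
      intro u w w'
      obtain ⟨e, t, f, g, k, rfl, rfl, rfl⟩ := M.exists_starFun₃ u w w'
      simp only [pair_starFun]
      exact M.starFun_starFun (b := Ty.prod a (Ty.prod b b)) (c := Ty.prod a b) _ _ _
    have hf₂ : ∀ u w w', M.starFun (a := Ty.prod a (Ty.prod b b)) (b := Ty.prod a b) f₂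
        (M.pair u (M.pair w w')) = M.pair u w' := by
      intro u w w'
      obtain ⟨e, t, f, g, k, rfl, rfl, rfl⟩ := M.exists_starFun₃ u w w'
      simp only [pair_starFun]
      exact M.starFun_starFun (b := Ty.prod a (Ty.prod b b)) (c := Ty.prod a b) _ _ _
    have hne : ∀ u w w', M.pair u (M.pair w w') ∈ {p : M.D (Ty.prod a (Ty.prod b b)) |
        ∀ᶠ s : Std a × Std b × Std b in M.ultra p, s.2.1 ≠ s.2.2} ↔ w ≠ w' := by
      intro u w w'
      obtain ⟨e, t, f, g, k, rfl, rfl, rfl⟩ := M.exists_starFun₃ u w w'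
      rw [ne_eq, starFun_eq_starFun_iff, ← Ultrafilter.eventually_not]
      simp only [pair_starFun, Set.mem_ofPred_eq, ultra_starFun]
      rfl
    obtain ⟨p, hp⟩ := exists_mem_iInter (Y := fun i =>
      {p : M.D (Ty.prod a (Ty.prod b b)) |
        ∀ᶠ s : Std a × Std b × Std b in M.ultra p, s.2.1 ≠ s.2.2} ∩
      (M.starFun (a := Ty.prod a (Ty.prod b b)) (b := Ty.prod a b) f₁ ⁻¹'
        T (fun i => z ∈ Y i) i ∩
       M.starFun (a := Ty.prod a (Ty.prod b b)) (b := Ty.prod a b) f₂ ⁻¹'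
        T (fun i => z ∈ Y i) i))
      (fun i => (M.isInternal_eventually _).inter
        (((hT (fun i => z ∈ Y i) i).preimage (a := Ty.prod a (Ty.prod b b)) (b := Ty.prod a b) f₁).inter
          ((hT (fun i => z ∈ Y i) i).preimage (a := Ty.prod a (Ty.prod b b)) (b := Ty.prod a b) f₂))) fun k => by
        have := hcon k
        unfold IsFunctional at this
        push Not at this
        obtain ⟨u, w, w', h1, h2, h3⟩ := this
        refine ⟨M.pair u (M.pair w w'), Set.mem_iInter₂.2 fun i hi => ⟨(hne u w w').2 h3, ?_, ?_⟩⟩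
        · rw [Set.mem_preimage, hf₁]
          exact Set.mem_iInter₂.1 h1 i hi
        · rw [Set.mem_preimage, hf₂]
          exact Set.mem_iInter₂.1 h2 i hi
    obtain ⟨u, q, rfl⟩ := M.exists_eq_pair p
    obtain ⟨w, w', rfl⟩ := M.exists_eq_pair q
    rw [Set.mem_iInter] at hp
    simp only [Set.mem_inter_iff, Set.mem_preimage, hf₁, hf₂, hne, hmT] at hp
    exact (hp 0).1 (hfun u w w' (hYF z _ (fun m => (hp m).2.1.symm) hz)
      (hYF z _ (fun m => (hp m).2.2.symm) hz))

/-- If `v` is infinite, a countably determined functional relation cannot take all the values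
below `v` on arguments that are infinitely smaller than `v`. -/
theorem IsCD.not_forall_lt_exists {F : Set (M.D (Ty.prod Ty.nat Ty.nat))} (hF : M.IsCD F)
    (hfun : IsFunctional F) {v : M.HNat} (hv : v ∉ M.stdNat) :
    ¬ ∀ w, M.lt w v → ∃ u, M.pair u w ∈ F ∧
      ∀ k : ℕ, M.lt (M.mul u (M.star (a := Ty.nat) k)) v := by
  intro h
  obtain ⟨A, hA, hcov⟩ := hF.exists_functional_cover hfun
  obtain ⟨w, hw, hwA⟩ := exists_notMem_smallImage A hA hv
  obtain ⟨u, huF, hu⟩ := h w hw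
  obtain ⟨n, hn⟩ := Set.mem_iUnion.1 (hcov huF)
  exact hwA n ⟨u, hu _, hn⟩

/-! ### Standard parts of ratios and the classification of intervals. -/

theorem mem_stdNat_of_le {x : M.HNat} {n : ℕ} (h : M.le x (M.star (a := Ty.nat) n)) :
    ∃ k ≤ n, x = M.star (a := Ty.nat) k := by
  have hx : x ∈ M.stdNat := by
    by_contra hx
    have h1 := (ultra_le_atTop hx) (Ioi_mem_atTop n)
    rw [← M.starFun_const (b := Ty.nat) n x] at h
    conv at h =>
      arg 2
      rw [← M.starFun_id x]
    rw [le_starFun] at h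
    obtain ⟨k, h2, h3⟩ := (h.and h1).exists
    exact absurd h2 (Nat.not_le.2 h3)
  obtain ⟨k, rfl⟩ := hx
  refine ⟨k, ?_, rfl⟩
  change M.le (M.star (a := Ty.nat) k) (M.star (a := Ty.nat) n) at h
  unfold le starRel at h
  rw [← star_pair, mem_star_star] at h
  exact h

theorem le_star_star {k n : ℕ} (h : k ≤ n) :
    M.le (M.star (a := Ty.nat) k) (M.star (a := Ty.nat) n) := by
  unfold le starRel
  rw [← star_pair, mem_star_star]
  exact h

theorem starFun_injective {f : Std a → Std b} (hf : Function.Injective f) :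
    Function.Injective (M.starFun f) := by
  intro x y h
  obtain ⟨e, t, g, k, rfl, rfl⟩ := M.exists_starFun₂ x y
  rw [starFun_starFun, starFun_starFun, starFun_eq_starFun_iff] at h
  rw [starFun_eq_starFun_iff]
  exact h.mono fun s hs => hf hs

theorem starFun_id_injOn (X : Set M.HNat) :
    Set.InjOn (M.starFun (a := Ty.nat) (b := Ty.nat) (fun n => n)) X :=
  (starFun_injective (a := Ty.nat) (b := Ty.nat) (f := fun n => n) fun _ _ h => h).injOn

theorem near_star_iff {α : M.HReal} {r : ℝ} :
    M.Near α (M.star (a := Ty.real) r) ↔ (M.ultra α : Filter ℝ) ≤ 𝓝 r := by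
  have key : ∀ ε : ℝ, M.starRel (a := Ty.real) (b := Ty.real) (fun s t : ℝ => s < t)
      (M.starFun (a := Ty.prod Ty.real Ty.real) (b := Ty.real) (fun p : ℝ × ℝ => |p.1 - p.2|)
        (M.pair α (M.star (a := Ty.real) r))) (M.star (a := Ty.real) ε) ↔
      ∀ᶠ s : ℝ in (M.ultra α : Filter ℝ), |s - r| < ε := by
    intro ε
    have h1 : M.starFun (a := Ty.prod Ty.real Ty.real) (b := Ty.real)
        (fun p : ℝ × ℝ => |p.1 - p.2|) (M.pair α (M.star (a := Ty.real) r)) =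
        M.starFun (a := Ty.real) (b := Ty.real) (fun s : ℝ => |s - r|) α := by
      have h2 : M.pair α (M.star (a := Ty.real) r) = M.starFun (a := Ty.real)
          (b := Ty.prod Ty.real Ty.real) (fun s : ℝ => (s, r)) α := by
        have h := M.pair_starFun (a := Ty.real) (b := Ty.real) (c := Ty.real) (fun s => s)
          (fun _ => r) α
        rwa [M.starFun_id (a := Ty.real), M.starFun_const (a := Ty.real) (b := Ty.real)] at h
      rw [h2]
      exact M.starFun_starFun (b := Ty.prod Ty.real Ty.real) (c := Ty.real) _ _ _
    rw [h1, ← M.starFun_const (b := Ty.real) ε α]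
    exact M.starRel_starFun (b := Ty.real) (c := Ty.real) _ _ _ α
  unfold Near
  simp only [key]
  rw [Metric.nhds_basis_ball.ge_iff]
  exact Iff.rfl

theorem st_eq_of_le_nhds {α : M.HReal} {r : ℝ} (h : (M.ultra α : Filter ℝ) ≤ 𝓝 r) :
    M.st α = (r : EReal) := by
  have h' : ∃ r : ℝ, M.Near α (M.star (a := Ty.real) r) := ⟨r, near_star_iff.2 h⟩
  rw [st, dif_pos h', ultra_nhds_unique (near_star_iff.1 h'.choose_spec) h]

theorem st_eq_top {α : M.HReal} (h : ¬ ∃ r : ℝ, (M.ultra α : Filter ℝ) ≤ 𝓝 r) :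
    M.st α = ⊤ := by
  rw [st, dif_neg]
  exact fun ⟨r, hr⟩ => h ⟨r, near_star_iff.1 hr⟩

theorem exists_le_mul_of_st {x y : M.HNat} (h0 : 0 < M.st (M.ratio x y))
    (h1 : M.st (M.ratio x y) < ⊤) : ∃ n : ℕ, M.le x (M.mul y (M.star (a := Ty.nat) n)) ∧
      M.le y (M.mul x (M.star (a := Ty.nat) n)) := by
  have h : ∃ r : ℝ, (M.ultra (M.ratio x y) : Filter ℝ) ≤ 𝓝 r := by
    by_contra h
    exact h1.ne (st_eq_top h)
  obtain ⟨r, hr⟩ := h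
  rw [st_eq_of_le_nhds hr] at h0
  have hr0 : 0 < r := by exact_mod_cast h0
  obtain ⟨e, t, f, g, rfl, rfl⟩ := M.exists_starFun₂ x y
  rw [ultra_ratio_le_nhds] at hr
  -- Eventually `r / 2 < x / y < r + 1`; the two terms of the maximum bound `x / y` and `y / x`.
  obtain ⟨n, hn⟩ := exists_nat_gt (max (r + 1) (2 / r))
  obtain ⟨hn1, hn2⟩ := max_lt_iff.1 hn
  refine ⟨n, ?_⟩
  rw [← M.starFun_const (b := Ty.nat) n t, mul_starFun, mul_starFun, le_starFun, le_starFun,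
    ← eventually_and]
  filter_upwards [hr.eventually (lt_mem_nhds (half_lt_self hr0)),
    hr.eventually (gt_mem_nhds (lt_add_one r))] with s h2 h3
  -- A zero denominator would make the quotient `0`, against the lower bound `r / 2`.
  have hg : (0 : ℝ) < g s := by
    rcases (Nat.cast_nonneg (α := ℝ) (g s)).eq_or_lt with h | h
    · rw [← h, div_zero] at h2
      linarith
    · exact h
  rw [lt_div_iff₀ hg] at h2
  rw [div_lt_iff₀ hg] at h3
  rw [div_lt_iff₀ hr0] at hn2
  constructor
  · have : (f s : ℝ) ≤ g s * n := by nlinarith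
    exact_mod_cast this
  · have : (g s : ℝ) ≤ f s * n := by
      have h4 : (0 : ℝ) ≤ n := Nat.cast_nonneg n
      nlinarith
    exact_mod_cast this

/-- If the ratio has a real standard part, that part is at most `0` and `x / y` is infinitesimal. If
it has none, the ratio exceeds every standard bound, because a bounded one would converge. -/
theorem forall_mul_lt_of_not_st {x y : M.HNat} (hy : y ≠ M.star (a := Ty.nat) (0 : ℕ))
    (h : ¬ (0 < M.st (M.ratio x y) ∧ M.st (M.ratio x y) < ⊤)) :
    (∀ k : ℕ, M.lt (M.mul x (M.star (a := Ty.nat) k)) y) ∨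
      ∀ k : ℕ, M.lt (M.mul y (M.star (a := Ty.nat) k)) x := by
  by_cases hlim : ∃ r : ℝ, (M.ultra (M.ratio x y) : Filter ℝ) ≤ 𝓝 r
  · left
    obtain ⟨r, hr⟩ := hlim
    rw [st_eq_of_le_nhds hr] at h
    have hr0 : r ≤ 0 := by
      by_contra! h0
      exact h ⟨by exact_mod_cast h0, EReal.coe_lt_top r⟩
    intro k
    obtain ⟨e, t, f, g, rfl, rfl⟩ := M.exists_starFun₂ x y
    rw [ultra_ratio_le_nhds] at hr
    rw [← M.starFun_const (b := Ty.nat) _ t, ne_eq, starFun_eq_starFun_iff,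
      ← Ultrafilter.eventually_not] at hy
    rw [← M.starFun_const (b := Ty.nat) _ t, mul_starFun, lt_starFun]
    have hk : (0 : ℝ) < 1 / (k + 1) := by positivity
    filter_upwards [hy, hr.eventually (gt_mem_nhds (hr0.trans_lt hk))] with s h1 h2
    have hg : (0 : ℝ) < g s := by exact_mod_cast Nat.pos_of_ne_zero h1
    rw [div_lt_div_iff₀ hg (by positivity)] at h2
    have h3 : (0 : ℝ) ≤ f s := Nat.cast_nonneg _
    have h4 : (f s * k : ℝ) < g s := by nlinarith
    exact_mod_cast h4
  · right
    intro k
    rw [lt_iff_not_le]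
    intro hle
    apply hlim
    apply exists_ultra_le_nhds (l := 0) (u := k)
    obtain ⟨e, t, f, g, rfl, rfl⟩ := M.exists_starFun₂ x y
    rw [← M.starFun_const (b := Ty.nat) _ t, mul_starFun, le_starFun] at hle
    rw [ratio_starFun, ultra_starFun, eventually_map]
    refine hle.mono fun s hs => ⟨by positivity, ?_⟩
    apply div_le_of_le_mul₀ (by positivity) (by positivity)
    rw [mul_comm]
    exact_mod_cast hs

theorem CDLe.mono_right {X : Set (M.D a)} {Y Z : Set (M.D b)} (h : M.CDLe X Y) (hYZ : Y ⊆ Z) :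
    M.CDLe X Z := by
  obtain ⟨f, hf, hcd⟩ := h
  exact ⟨fun x => ⟨f x, hYZ (f x).2⟩,
    fun x y hxy => hf (Subtype.ext (congrArg (fun z : Z => (z : M.D b)) hxy)), hcd⟩

theorem mul_le_mul_right {x y : M.HNat} (h : M.le x y) (z : M.HNat) :
    M.le (M.mul x z) (M.mul y z) := by
  obtain ⟨e, t, f, g, k, rfl, rfl, rfl⟩ := M.exists_starFun₃ x y z
  rw [le_starFun] at h
  rw [mul_starFun, mul_starFun, le_starFun]
  exact h.mono fun s hs => Nat.mul_le_mul_right _ hs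

theorem lt_of_le_of_lt {x y z : M.HNat} (h : M.le x y) (h' : M.lt y z) : M.lt x z := by
  obtain ⟨e, t, f, g, k, rfl, rfl, rfl⟩ := M.exists_starFun₃ x y z
  rw [le_starFun] at h
  rw [lt_starFun] at h' ⊢
  exact (h.and h').mono fun _ h => h.1.trans_lt h.2

theorem le_mul_one (x : M.HNat) : M.le x (M.mul x (M.star (a := Ty.nat) (1 : ℕ))) := by
  obtain ⟨e, t, f, -, rfl, -⟩ := M.exists_starFun₂ x x
  rw [← M.starFun_const (b := Ty.nat) _ t, mul_starFun, le_starFun]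
  exact Eventually.of_forall fun s => (Nat.mul_one _).ge

/-- The inverse of an injection is a functional relation that takes all values below `y` on
arguments below `x`, all infinitely smaller than `y`. -/
theorem not_cdLe_below {x y : M.HNat} (hy : y ∉ M.stdNat)
    (h : ∀ k : ℕ, M.lt (M.mul x (M.star (a := Ty.nat) k)) y) :
    ¬ M.CDLe (M.below y) (M.below x) := by
  rintro ⟨f, hf, hcd⟩
  have hswap : ∀ u w : M.HNat, M.starFun (a := Ty.prod Ty.nat Ty.nat) (b := Ty.prod Ty.nat Ty.nat)
      (Prod.swap : ℕ × ℕ → ℕ × ℕ) (M.pair u w) = M.pair w u := by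
    intro u w
    obtain ⟨e, t, g, k, rfl, rfl⟩ := M.exists_starFun₂ u w
    rw [pair_starFun, pair_starFun]
    exact M.starFun_starFun (b := Ty.prod Ty.nat Ty.nat) (c := Ty.prod Ty.nat Ty.nat) _ _ _
  have hcd' := IsCD.preimage (a := Ty.prod Ty.nat Ty.nat) (b := Ty.prod Ty.nat Ty.nat) hcd
    (Prod.swap : ℕ × ℕ → ℕ × ℕ)
  refine hcd'.not_forall_lt_exists (fun u w w' h1 h2 => ?_) hy fun w hw => ?_
  · rw [Set.mem_preimage, hswap] at h1 h2
    obtain ⟨z, hz⟩ := h1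
    obtain ⟨z', hz'⟩ := h2
    obtain ⟨rfl, e1⟩ := by simpa using M.eq_pair_iff.1 hz
    obtain ⟨rfl, e2⟩ := by simpa using M.eq_pair_iff.1 hz'
    exact congrArg Subtype.val (hf (Subtype.ext (e1.symm.trans e2)))
  · refine ⟨f ⟨w, hw⟩, ?_, fun k => lt_of_le_of_lt (mul_le_mul_right (le_of_lt (f ⟨w, hw⟩).2) _)
      (h k)⟩
    rw [Set.mem_preimage, hswap]
    exact ⟨⟨w, hw⟩, rfl⟩

theorem cdEquiv_below_iff {x y : M.HNat} (hy : y ≠ M.star (a := Ty.nat) (0 : ℕ))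
    (hxy : x ∉ M.stdNat ∨ y ∉ M.stdNat) : M.CDEquiv (M.below x) (M.below y) ↔
      0 < M.st (M.ratio x y) ∧ M.st (M.ratio x y) < ⊤ := by
  -- A number bounded by a standard multiple of a standard number is standard, so infinitude passes
  -- to whichever endpoint has to be infinite.
  have hstd : ∀ {x y : M.HNat} {n : ℕ}, M.le x (M.mul y (M.star (a := Ty.nat) n)) →
      x ∉ M.stdNat → y ∉ M.stdNat := by
    rintro x y n hle hx ⟨m, rfl⟩
    have : M.mul (M.star (a := Ty.nat) m) (M.star (a := Ty.nat) n) =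
        M.star (a := Ty.nat) (m * n : ℕ) := by
      unfold mul
      rw [← star_pair]
      exact M.starFun_star (a := Ty.prod Ty.nat Ty.nat) (b := Ty.nat) _ _
    change M.le x (M.mul (M.star (a := Ty.nat) m) (M.star (a := Ty.nat) n)) at hle
    rw [this] at hle
    obtain ⟨k, -, rfl⟩ := mem_stdNat_of_le hle
    exact hx ⟨k, rfl⟩
  have hstd' : ∀ {x y : M.HNat}, (∀ k : ℕ, M.lt (M.mul x (M.star (a := Ty.nat) k)) y) →
      (x ∉ M.stdNat ∨ y ∉ M.stdNat) → y ∉ M.stdNat := by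
    intro x y h hxy
    refine hxy.elim (fun hx => ?_) id
    exact hstd (n := 1) (le_trans (le_trans (le_mul_one x) (le_of_lt (h 1))) (le_mul_one y)) hx
  constructor
  · rintro ⟨h1, h2⟩
    by_contra hcon
    rcases forall_mul_lt_of_not_st hy hcon with h | h
    · exact not_cdLe_below (hstd' h hxy) h h2
    · exact not_cdLe_below (hstd' h hxy.symm) h h1
  · rintro ⟨h0, h1⟩
    obtain ⟨n, h2, h3⟩ := exists_le_mul_of_st h0 h1
    have hx : x ∉ M.stdNat := hxy.elim id (hstd h3)
    have hy : y ∉ M.stdNat := hstd h2 hx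
    have key : ∀ {x y : M.HNat}, y ∉ M.stdNat → M.le x (M.mul y (M.star (a := Ty.nat) n)) →
        M.CDLe (M.below x) (M.below y) := by
      intro x y hy hle
      refine cdLe_below (isInternal_below x).isCD (fun n => n) (starFun_id_injOn _) hy
        fun z hz => ⟨n, ?_⟩
      rw [M.starFun_id (a := Ty.nat)]
      exact le_trans (le_of_lt hz) hle
    exact ⟨key hy h2, key hx h3⟩

theorem IsAdditive.mul_mem {U : Set M.HNat} (hadd : M.IsAdditive U) (hU : M.IsCut U) {x : M.HNat}
    (hx : x ∈ U) (n : ℕ) : M.mul x (M.star (a := Ty.nat) n) ∈ U := by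
  induction n with
  | zero =>
    refine hU x hx _ ?_
    obtain ⟨e, t, f, -, rfl, -⟩ := M.exists_starFun₂ x x
    rw [← M.starFun_const (b := Ty.nat) _ t, mul_starFun, le_starFun]
    exact Eventually.of_forall fun s => by simp
  | succ n ih =>
    have : M.mul x (M.star (a := Ty.nat) (n + 1 : ℕ)) =
        M.add (M.mul x (M.star (a := Ty.nat) n)) x := by
      obtain ⟨e, t, f, -, rfl, -⟩ := M.exists_starFun₂ x x
      rw [← M.starFun_const (b := Ty.nat) _ t, ← M.starFun_const (b := Ty.nat) _ t, mul_starFun,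
        mul_starFun, add_starFun]
      rfl
    rw [this]
    exact hadd _ ih _ hx

theorem star_le_mul_star {x : M.HNat} (hx : x ≠ M.star (a := Ty.nat) (0 : ℕ)) (n : ℕ) :
    M.le (M.star (a := Ty.nat) n) (M.mul x (M.star (a := Ty.nat) n)) := by
  obtain ⟨e, t, f, -, rfl, -⟩ := M.exists_starFun₂ x x
  rw [← M.starFun_const (b := Ty.nat) _ t, ne_eq, starFun_eq_starFun_iff,
    ← Ultrafilter.eventually_not] at hx
  rw [← M.starFun_const (b := Ty.nat) _ t, mul_starFun, le_starFun]
  exact hx.mono fun s hs => Nat.le_mul_of_pos_left _ (Nat.pos_of_ne_zero hs)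

theorem star_zero_le (x : M.HNat) : M.le (M.star (a := Ty.nat) (0 : ℕ)) x := by
  obtain ⟨e, t, f, -, rfl, -⟩ := M.exists_starFun₂ x x
  rw [← M.starFun_const (b := Ty.nat) _ t, le_starFun]
  exact Eventually.of_forall fun s => Nat.zero_le _

theorem not_exists_surjective {U V : Set M.HNat} (hU : M.IsCut U) (hV : M.IsCut V) (hUV : U ⊂ V)
    (hadd : M.IsAdditive U) : ¬ ∃ φ : U → V, Function.Surjective φ ∧ M.IsCDMap φ := by
  rintro ⟨φ, hφ, hcd⟩
  obtain ⟨v, hvV, hvU⟩ := Set.exists_of_ssubset hUV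
  obtain ⟨⟨u₀, hu₀⟩, -⟩ := hφ ⟨v, hvV⟩
  have h0 : M.star (a := Ty.nat) (0 : ℕ) ∈ U := hU u₀ hu₀ _ (star_zero_le _)
  -- With a nonzero element, an additive cut contains every standard number, so `v` is infinite. The
  -- cut `{0}` is excluded from this and cannot map onto both `0` and `v`.
  by_cases hU0 : ∃ u ∈ U, u ≠ M.star (a := Ty.nat) (0 : ℕ)
  · obtain ⟨u, hu, hne⟩ := hU0
    have hv : v ∉ M.stdNat := by
      rintro ⟨n, rfl⟩
      exact hvU (hU _ (hadd.mul_mem hU hu n) _ (star_le_mul_star hne n))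
    refine IsCD.not_forall_lt_exists hcd (fun u w w' h1 h2 => ?_) hv fun w hw => ?_
    · obtain ⟨z, hz⟩ := h1
      obtain ⟨z', hz'⟩ := h2
      obtain ⟨e1, rfl⟩ := by simpa using M.eq_pair_iff.1 hz
      obtain ⟨e2, rfl⟩ := by simpa using M.eq_pair_iff.1 hz'
      rw [show z = z' from Subtype.ext (e1.symm.trans e2)]
    · obtain ⟨z, hz⟩ := hφ ⟨w, hV v hvV w (le_of_lt hw)⟩
      refine ⟨z, ⟨z, by rw [hz]⟩, fun k => ?_⟩
      rw [lt_iff_not_le]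
      exact fun hle => hvU (hU _ (hadd.mul_mem hU z.2 k) _ hle)
  · push Not at hU0
    obtain ⟨z, hz⟩ := hφ ⟨v, hvV⟩
    obtain ⟨z', hz'⟩ := hφ ⟨M.star (a := Ty.nat) (0 : ℕ), hUV.1 h0⟩
    have hzz : z = z' := Subtype.ext ((hU0 z z.2).trans (hU0 z' z'.2).symm)
    rw [← hzz, hz] at hz'
    have hv0 : v = _ := congrArg Subtype.val hz'
    exact hvU (hv0 ▸ h0)

/-! ### Infinite cuts, their products with `ℕ` and their standard multiples. -/

theorem star_mem_of_infinite {U : Set M.HNat} (hU : M.IsCut U) (hinf : U.Infinite) (n : ℕ) :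
    M.star (a := Ty.nat) n ∈ U := by
  by_contra hn
  refine hinf (((Set.finite_Iic n).image fun k : ℕ => M.star (a := Ty.nat) k).subset fun x hx => ?_)
  rcases le_total x (M.star (a := Ty.nat) n) with h | h
  · obtain ⟨k, hk, rfl⟩ := mem_stdNat_of_le h
    exact ⟨k, hk, rfl⟩
  · exact absurd (hU x hx _ h) hn

theorem subset_mulNat (U : Set M.HNat) : U ⊆ M.mulNat U := fun x hx =>
  Set.mem_iUnion.2 ⟨1, Set.mem_iUnion₂.2 ⟨x, hx, le_mul_one x⟩⟩

theorem IsAdditive.mulNat_eq {U : Set M.HNat} (hadd : M.IsAdditive U) (hU : M.IsCut U) :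
    M.mulNat U = U := by
  refine Set.Subset.antisymm (fun y hy => ?_) (subset_mulNat U)
  obtain ⟨n, hn⟩ := Set.mem_iUnion.1 hy
  obtain ⟨x, hx, hxy⟩ := Set.mem_iUnion₂.1 hn
  exact hU _ (hadd.mul_mem hU hx n) _ hxy

/-- An infinite cut `U` that is not additive satisfies `Uℕ = xℕ` for some infinite `x ∈ U`. -/
theorem exists_mulNat_eq {U : Set M.HNat} (hU : M.IsCut U) (hinf : U.Infinite)
    (hadd : ¬ M.IsAdditive U) : ∃ x ∈ U, x ∉ M.stdNat ∧
      M.mulNat U = ⋃ n : ℕ, {y | M.le y (M.mul x (M.star (a := Ty.nat) n))} := by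
  -- The larger of two elements whose sum leaves `U`; every element of `U` is then below `x + x`, so
  -- `U` and `x` have the same standard multiples up to a factor `2`.
  have h : ∃ x ∈ U, M.add x x ∉ U := by
    unfold IsAdditive at hadd
    push Not at hadd
    obtain ⟨x, hx, y, hy, hxy⟩ := hadd
    have key : ∀ {x y : M.HNat}, M.le x y →
        M.le (M.add x y) (M.add y y) ∧ M.le (M.add y x) (M.add y y) := by
      intro x y h
      obtain ⟨e, t, f, g, rfl, rfl⟩ := M.exists_starFun₂ x y
      rw [le_starFun] at h
      rw [add_starFun, add_starFun, add_starFun, le_starFun, le_starFun, ← eventually_and]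
      exact h.mono fun s hs => ⟨by omega, by omega⟩
    rcases le_total x y with h | h
    · exact ⟨y, hy, fun h' => hxy (hU _ h' _ (key h).1)⟩
    · exact ⟨x, hx, fun h' => hxy (hU _ h' _ (key h).2)⟩
  obtain ⟨x, hx, hxx⟩ := h
  refine ⟨x, hx, ?_, Set.Subset.antisymm (fun y hy => ?_) fun y hy => ?_⟩
  · rintro ⟨n, rfl⟩
    apply hxx
    change M.add (M.star (a := Ty.nat) n) (M.star (a := Ty.nat) n) ∈ U
    unfold add
    rw [← star_pair, M.starFun_star (a := Ty.prod Ty.nat Ty.nat) (b := Ty.nat)]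
    exact star_mem_of_infinite hU hinf _
  · obtain ⟨n, hn⟩ := Set.mem_iUnion.1 hy
    obtain ⟨z, hz, hzy⟩ := Set.mem_iUnion₂.1 hn
    have hlt : M.lt z (M.add x x) := (lt_iff_not_le _ _).2 fun hle => hxx (hU _ hz _ hle)
    refine Set.mem_iUnion.2 ⟨2 * n, ?_⟩
    rw [Set.mem_ofPred_eq] at hzy ⊢
    obtain ⟨e, t, f, g, k, rfl, rfl, rfl⟩ := M.exists_starFun₃ x y z
    rw [add_starFun, lt_starFun] at hlt
    rw [← M.starFun_const (b := Ty.nat) _ t, mul_starFun, le_starFun] at hzy ⊢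
    refine (hlt.and hzy).mono fun s hs => hs.2.trans ?_
    calc k s * n ≤ (f s + f s) * n := Nat.mul_le_mul_right _ hs.1.le
      _ = f s * (2 * n) := by ring
  · obtain ⟨n, hn⟩ := Set.mem_iUnion.1 hy
    exact Set.mem_iUnion.2 ⟨n, Set.mem_iUnion₂.2 ⟨x, hx, hn⟩⟩

/-- The injection `(n, x) ↦ 2 ^ n * (2 * x + 1)`. -/
def pairing (p : ℕ × ℕ) : ℕ := 2 ^ p.1 * (2 * p.2 + 1)

theorem pairing_injective : Function.Injective pairing := by
  rintro ⟨n, x⟩ ⟨m, y⟩ h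
  simp only [pairing] at h
  have key : ∀ n m x y : ℕ, 2 ^ n * (2 * x + 1) = 2 ^ m * (2 * y + 1) → n ≤ m → n = m := by
    intro n m x y h hnm
    obtain ⟨k, rfl⟩ := Nat.exists_eq_add_of_le hnm
    rw [pow_add, mul_assoc] at h
    have h' := Nat.eq_of_mul_eq_mul_left (by positivity) h
    rcases k with _ | k
    · rfl
    · rw [pow_succ, mul_assoc, mul_left_comm] at h'
      omega
  have hnm : n = m := (Nat.le_total n m).elim (key n m x y h) fun h' => (key m n y x h.symm h').symm
  subst hnm
  have h' := Nat.eq_of_mul_eq_mul_left (by positivity) h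
  rw [show x = y by omega]

theorem starFun_pairing_mem {U : Set M.HNat} (hU : M.IsCut U) (hinf : U.Infinite)
    {z : M.D (Ty.prod Ty.nat Ty.nat)} (hz : z ∈ M.prodSet M.stdNat U) :
    M.starFun (a := Ty.prod Ty.nat Ty.nat) (b := Ty.nat) pairing z ∈ M.mulNat U := by
  obtain ⟨_, ⟨n, rfl⟩, x, hx, rfl⟩ := hz
  -- `y` is the maximum of `x` and `1`, which gives `2 * x + 1 ≤ 3 * y` even for `x = 0`.
  have h : ∃ y ∈ U, M.le x y ∧ M.le (M.star (a := Ty.nat) (1 : ℕ)) y := by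
    rcases le_total x (M.star (a := Ty.nat) (1 : ℕ)) with h | h
    · exact ⟨_, star_mem_of_infinite hU hinf 1, h, le_star_star le_rfl⟩
    · exact ⟨x, hx, (le_total x x).elim id id, h⟩
  obtain ⟨y, hy, hxy, h1y⟩ := h
  refine Set.mem_iUnion.2 ⟨2 ^ n * 3, Set.mem_iUnion₂.2 ⟨y, hy, ?_⟩⟩
  rw [Set.mem_ofPred_eq]
  change M.le (M.starFun (a := Ty.prod Ty.nat Ty.nat) (b := Ty.nat) pairing
    (M.pair (M.star (a := Ty.nat) n) x)) _
  obtain ⟨e, t, f, g, rfl, rfl⟩ := M.exists_starFun₂ x y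
  rw [← M.starFun_const (b := Ty.nat) _ t, le_starFun] at h1y
  rw [le_starFun] at hxy
  rw [← M.starFun_const (b := Ty.nat) n t, ← M.starFun_const (b := Ty.nat) (2 ^ n * 3) t,
    pair_starFun, mul_starFun,
    M.starFun_starFun (b := Ty.prod Ty.nat Ty.nat) (c := Ty.nat) pairing, le_starFun]
  refine (hxy.and h1y).mono fun s hs => ?_
  have h1 : f s ≤ g s := hs.1
  have h2 : 1 ≤ g s := hs.2
  calc 2 ^ n * (2 * f s + 1) ≤ 2 ^ n * (g s * 3) := Nat.mul_le_mul_left _ (by omega)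
    _ = g s * (2 ^ n * 3) := by ring

theorem cdEquiv_of_infinite {U : Set M.HNat} (hU : M.IsCut U) (hcd : M.IsCD U)
    (hinf : U.Infinite) :
    M.CDEquiv U (M.prodSet M.stdNat U) ∧ M.CDEquiv U (M.mulNat U) := by
  have h1 : M.CDLe U (M.prodSet M.stdNat U) := by
    have hf : ∀ x : M.HNat, M.starFun (a := Ty.nat) (b := Ty.prod Ty.nat Ty.nat)
        (fun n : ℕ => ((0 : ℕ), n)) x = M.pair (M.star (a := Ty.nat) (0 : ℕ)) x := by
      intro x
      have h := M.pair_starFun (a := Ty.nat) (b := Ty.nat) (c := Ty.nat) (fun _ => 0) (fun n => n) x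
      rw [M.starFun_id (a := Ty.nat), M.starFun_const (a := Ty.nat) (b := Ty.nat)] at h
      exact h.symm
    refine cdLe_of_starFun (a := Ty.nat) (b := Ty.prod Ty.nat Ty.nat) hcd
      (fun n : ℕ => ((0 : ℕ), n)) (fun x hx => ?_)
      (starFun_injective (a := Ty.nat) (b := Ty.prod Ty.nat Ty.nat)
        fun m n h => congrArg Prod.snd h).injOn
    rw [hf]
    exact ⟨_, ⟨0, rfl⟩, x, hx, rfl⟩
  have h2 : M.CDLe U (M.mulNat U) := cdLe_of_subset hcd (subset_mulNat U)
  have hinj : Function.Injective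
      (M.starFun (a := Ty.prod Ty.nat Ty.nat) (b := Ty.nat) pairing) :=
    starFun_injective (a := Ty.prod Ty.nat Ty.nat) (b := Ty.nat) pairing_injective
  have hmem := fun z hz => starFun_pairing_mem (z := z) hU hinf hz
  -- In the additive case `Uℕ = U`, and the pairing function itself maps into `U`. Otherwise both `ℕ
  -- × U` and `Uℕ` embed into some `xℕ`, hence into `[0, x) ⊆ U`.
  by_cases hadd : M.IsAdditive U
  · rw [hadd.mulNat_eq hU] at h2 hmem ⊢
    exact ⟨⟨h1, cdLe_of_starFun (a := Ty.prod Ty.nat Ty.nat) (b := Ty.nat)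
      (isCD_stdNat.prodSet hcd) pairing hmem hinj.injOn⟩, h2, h2⟩
  · obtain ⟨x, hx, hstd, heq⟩ := exists_mulNat_eq hU hinf hadd
    have hbelow : M.below x ⊆ U := fun y hy => hU x hx y (le_of_lt hy)
    have hcd' : M.IsCD (M.mulNat U) := by
      rw [heq]
      exact IsCD.iUnion fun n => (M.isInternal_starRel (a := Ty.nat) (b := Ty.nat)
        (fun m n : ℕ => m ≤ n) _).isCD
    refine ⟨⟨h1, (cdLe_below (a := Ty.prod Ty.nat Ty.nat) (isCD_stdNat.prodSet hcd) pairing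
      hinj.injOn hstd fun z hz => ?_).mono_right hbelow⟩, h2,
      (cdLe_below hcd' (fun n => n) (starFun_id_injOn _) hstd fun z hz => ?_).mono_right hbelow⟩
    · have := hmem z hz
      rw [heq] at this
      obtain ⟨n, hn⟩ := Set.mem_iUnion.1 this
      exact ⟨n, hn⟩
    · rw [M.starFun_id (a := Ty.nat)]
      rw [heq] at hz
      obtain ⟨n, hn⟩ := Set.mem_iUnion.1 hz
      exact ⟨n, hn⟩

end NonstandardUniverse

theorem mainTheorem6 (M : NonstandardUniverse.{u}) :
    (∀ U : Set M.HNat, M.IsCut U → M.IsBorel U → U.Infinite →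
      M.CDEquiv U (M.prodSet M.stdNat U) ∧ M.CDEquiv U (M.mulNat U)) ∧
    (∀ U V : Set M.HNat, M.IsCut U → M.IsBorel U → M.IsCut V → M.IsBorel V →
      U ⊂ V → M.IsAdditive U →
      ¬ ∃ φ : U → V, Function.Surjective φ ∧ M.IsCDMap φ) ∧
    (∀ x y : M.HNat, y ≠ M.star (a := Ty.nat) (0 : ℕ) → (x ∉ M.stdNat ∨ y ∉ M.stdNat) →
      (M.CDEquiv (M.below x) (M.below y) ↔
        0 < M.st (M.ratio x y) ∧ M.st (M.ratio x y) < ⊤)) :=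
  ⟨fun _ hU hB hinf => NonstandardUniverse.cdEquiv_of_infinite hU hB.isCD hinf,
    fun _ _ hU _ hV _ hUV hadd => NonstandardUniverse.not_exists_surjective hU hV hUV hadd,
    fun _ _ hy hxy => NonstandardUniverse.cdEquiv_below_iff hy hxy⟩
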